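/- Let $n\in\mathbb N$, and let $-\mathcal L$ be the generator of a bounded analytic semigroup $\{e^{-t\mathcal L}\}_{t>0}$ on $L^2(\mathbb R^n)$ (complex-valued functions) — that is, the semigroup extends to a strongly continuous, holomorphic, uniformly bounded semigroup on some sector $|\arg z|<\theta$, $0<\theta\le\pi/2$; this is the case in particular if $\mathcal L$ generates an analytic semigroup and has a bounded holomorphic functional calculus on $L^2(\mathbb R^n)$. Suppose that $e^{-t\mathcal L}f(x)=\int_{\mathbb R^n}\mathcal P_t(x,y)f(y)\,dy$ with a kernel $\mathcal P_t(x,y)$, measurable in $(t,x,y)$, satisfying for some constants $c,A>0$ $$|\mathcal P_t(x,y)|\le \frac{c}{t^{n/2}}\,e^{-A|x-y|^2/t}\qquad(x,y\in\mathbb R^n,\ t>0).$$ Use the same integral to define $e^{-t\mathcal L}f$ for functions $f\notin L^2$. Let $0<\alpha<n$, $1\le p<n/\alpha$, $\lambda=n-\alpha p$, and $$\mathcal L^{-\alpha/2}f(x)=\frac1{\Gamma(\alpha/2)}\int_0^\infty e^{-t\mathcal L}f(x)\,t^{\alpha/2-1}\,dt .$$ Notation ($B=B(x_0,r)$ is the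 open ball, $m$ is Lebesgue measure). * $VM^{p,\lambda}$ is the set of locally integrable $f$ such that, with $\mathcal M_{p,\lambda}(f;x_0,r)=m(B)^{-\lambda/(pn)}\big(\int_B|f|^p\,dx\big)^{1/p}$, one has $\|f\|_{VM^{p,\lambda}}:=\sup_{x_0\in\mathbb R^n,\,r>0}\mathcal M_{p,\lambda}(f;x_0,r)<\infty$ and $\lim_{r\to0^+}\sup_{x_0}\mathcal M_{p,\lambda}(f;x_0,r)=0$. * $\mathcal M$ is the set of locally integrable $g$ with $\int_{\mathbb R^n}|g(x)|^2(1+|x|)^{-n-\varrho}\,dx<\infty$ for some $\varrho>0$. * $\mathrm{BMO}_{\mathcal L}$ is the set of $g\in\mathcal M$ with $\|g\|_{\mathrm{BMO}_{\mathcal L}}:=\|M^\#_{\mathcal L}g\|_{L^\infty}<\infty$, where $M^\#_{\mathcal L}g(x)$ is the supremum of $\frac1{m(B)}\int_{B}|g-e^{-r^2\mathcal L}g|\,dy$ over all balls $B=B(x_0,r)$ containing $x$. * $\mathrm{VMO}_{\mathcal L}$ is the set of $g\in\mathrm{BMO}_{\mathcal L}$ with $\lim_{r\to0^+}\eta(g;r)=0$,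 where $\eta(g;r)=\sup_{x_0\in\mathbb R^n}\frac1{m(B)}\int_{B}|g-e^{-r^2\mathcal L}g|\,dy$; it carries the norm $\|g\|_{\mathrm{VMO}_{\mathcal L}}=\|g\|_{\mathrm{BMO}_{\mathcal L}}$. * $\mathcal L^{-\alpha/2}f$ is called *well defined* if $\int_{\mathbb R^n}\Big(\int_0^\infty|e^{-t\mathcal L}f(x)|\,t^{\alpha/2-1}\,dt\Big)(1+|x|)^{-N}\,dx<\infty$ for some $N$. **Theorem.** There is a constant $C>0$, independent of $f$, such that for every $f\in VM^{p,\lambda}(\mathbb R^n)$ the following hold. 1. If $\int_{\mathbb R^n}\frac{|f(y)|}{|x-y|^{n-\alpha}}\,dy<\infty$ for at least one $x\in\mathbb R^n$, then $\mathcal L^{-\alpha/2}f$ is well defined. 2. Whenever $\mathcal L^{-\alpha/2}f$ is well defined, $\mathcal L^{-\alpha/2}f\in\mathrm{VMO}_{\mathcal L}(\mathbb R^n)$, $$\|\mathcal L^{-\alpha/2}f\|_{\mathrm{VMO}_{\mathcal L}}\le C\,\|f\|_{VM^{p,\lambda}}\qquad\text{and}\qquad \lim_{r\to0^+}\eta(\mathcal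 L^{-\alpha/2}f;r)=0 .$$ -/

import Mathlib

open MeasureTheory Filter Topology Set
open scoped ENNReal

noncomputable section

namespace FracMorrey

/-- Euclidean space `ℝⁿ` with the Euclidean norm and Lebesgue measure. -/
abbrev Rn (n : ℕ) : Type := EuclideanSpace ℝ (Fin n)

/-- The complex Hilbert space `L²(ℝⁿ)`. -/
abbrev L2 (n : ℕ) : Type := Lp ℂ 2 (volume : Measure (Rn n))

/-! ### The operator and its semigroup -/

/-- The open sector `{z ≠ 0 : |arg z| < θ}`. -/
def sector (θ : ℝ) : Set ℂ := {z | z ≠ 0 ∧ |z.arg| < θ}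

/-- `(T t)_{t > 0}` is a bounded analytic semigroup: it extends to a holomorphic, uniformly bounded
semigroup on some sector around the positive half-line, strongly continuous at `0`. -/
def IsBoundedAnalyticSemigroup {E : Type*} [NormedAddCommGroup E] [NormedSpace ℂ E]
    (T : ℝ → E →L[ℂ] E) : Prop :=
  ∃ θ : ℝ, 0 < θ ∧ θ ≤ Real.pi / 2 ∧ ∃ S : ℂ → E →L[ℂ] E,
    (∀ t : ℝ, 0 < t → S t = T t) ∧
    DifferentiableOn ℂ S (sector θ) ∧
    (∀ z ∈ sector θ, ∀ w ∈ sector θ, S (z + w) = (S z).comp (S w)) ∧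
    (∀ u : E, Tendsto (fun z => S z u) (𝓝[sector θ] 0) (𝓝 u)) ∧
    ∃ M : ℝ, ∀ z ∈ sector θ, ‖S z‖ ≤ M

/-- `T t = e^{-tL}`: the (unbounded) operator `L` has as its domain exactly the vectors `u` for which
`(u - T t u) / t` converges as `t → 0⁺`, and `L u` is the limit. -/
def IsGeneratorOf {E : Type*} [NormedAddCommGroup E] [NormedSpace ℂ E]
    (L : E →ₗ.[ℂ] E) (T : ℝ → E →L[ℂ] E) : Prop :=
  ∀ u v : E, (∃ h : u ∈ L.domain, L ⟨u, h⟩ = v) ↔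
    Tendsto (fun t : ℝ => ((t⁻¹ : ℝ) : ℂ) • (u - T t u)) (𝓝[>] 0) (𝓝 v)

/-- The integral operator with kernel `P t`:  `e^{-tL} f (x) = ∫ P_t(x,y) f(y) dy`. -/
def heat {n : ℕ} (P : ℝ → Rn n → Rn n → ℂ) (t : ℝ) (f : Rn n → ℂ) (x : Rn n) : ℂ :=
  ∫ y, P t x y * f y

/-- `P` is a (jointly measurable) kernel of the semigroup `T` on `L²(ℝⁿ)`. -/
def IsKernelOf {n : ℕ} (P : ℝ → Rn n → Rn n → ℂ) (T : ℝ → L2 n →L[ℂ] L2 n) : Prop :=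
  Measurable (fun q : ℝ × Rn n × Rn n => P q.1 q.2.1 q.2.2) ∧
  ∀ t : ℝ, 0 < t → ∀ u : L2 n, (T t u : Rn n → ℂ) =ᵐ[volume] heat P t u

/-- Gaussian upper bound `|P_t(x,y)| ≤ C t^{-n/2} exp(-A |x-y|² / t)`. -/
def GaussianBound {n : ℕ} (P : ℝ → Rn n → Rn n → ℂ) : Prop :=
  ∃ C A : ℝ, 0 < C ∧ 0 < A ∧ ∀ t : ℝ, 0 < t → ∀ x y : Rn n,
    ‖P t x y‖ ≤ C / t ^ ((n : ℝ) / 2) * Real.exp (-A * (‖x - y‖ ^ 2 / t))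

/-! ### The generalized fractional integral -/

/-- `L^{-α/2} f (x) = Γ(α/2)⁻¹ ∫₀^∞ e^{-tL} f (x) t^{α/2-1} dt`. -/
def frac {n : ℕ} (P : ℝ → Rn n → Rn n → ℂ) (α : ℝ) (f : Rn n → ℂ) (x : Rn n) : ℂ :=
  (((Real.Gamma (α / 2))⁻¹ : ℝ) : ℂ) *
    ∫ t in Ioi (0 : ℝ), heat P t f x * ((t ^ (α / 2 - 1) : ℝ) : ℂ)

/-- `L^{-α/2} f` is well defined: `∫₀^∞ |e^{-tL} f (x)| t^{α/2-1} dt` is integrable in `x` against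
some power weight `(1+|x|)^{-N}` (in particular it is finite for almost every `x`). -/
def FracConverges {n : ℕ} (P : ℝ → Rn n → Rn n → ℂ) (α : ℝ) (f : Rn n → ℂ) : Prop :=
  ∃ N : ℝ, ∫⁻ x : Rn n, (∫⁻ t in Ioi (0 : ℝ), ‖heat P t f x‖ₑ * ENNReal.ofReal (t ^ (α / 2 - 1)))
    * ENNReal.ofReal ((1 + ‖x‖) ^ (-N)) < ∞

/-- The (unnormalized) Riesz potential `∫ |f(y)| / |x-y|^{n-α} dy`. -/
def rieszAbs {n : ℕ} (α : ℝ) (f : Rn n → ℂ) (x : Rn n) : ℝ≥0∞ :=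
  ∫⁻ y, ‖f y‖ₑ / ENNReal.ofReal (‖x - y‖ ^ ((n : ℝ) - α))

/-! ### Morrey spaces -/

/-- `m(B)^{-λ/(pn)} (∫_B |f|^p)^{1/p}` for the ball `B = B(x₀, r)`. -/
def morreyQ {n : ℕ} (p lam : ℝ) (f : Rn n → ℂ) (x₀ : Rn n) (r : ℝ) : ℝ≥0∞ :=
  (∫⁻ x in Metric.ball x₀ r, ‖f x‖ₑ ^ p) ^ (1 / p)
    / (volume (Metric.ball x₀ r)) ^ (lam / (p * n))

/-- The norm of `M^{p,λ}` (and of `VM^{p,λ}`). -/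
def morreyNorm {n : ℕ} (p lam : ℝ) (f : Rn n → ℂ) : ℝ≥0∞ :=
  ⨆ (x₀ : Rn n) (r : ℝ) (_ : 0 < r), morreyQ p lam f x₀ r

def MemMorrey {n : ℕ} (p lam : ℝ) (f : Rn n → ℂ) : Prop :=
  LocallyIntegrable f volume ∧ morreyNorm p lam f < ∞

/-- The vanishing Morrey space `VM^{p,λ}`. -/
def MemVMorrey {n : ℕ} (p lam : ℝ) (f : Rn n → ℂ) : Prop :=
  MemMorrey p lam f ∧
    Tendsto (fun r : ℝ => ⨆ x₀ : Rn n, morreyQ p lam f x₀ r) (𝓝[>] 0) (𝓝 0)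

/-! ### `BMO_L` and `VMO_L` -/

/-- The class `𝓜 = ⋃_{ϱ>0} 𝓜_ϱ`: locally integrable functions with
`∫ |g(x)|² / (1+|x|)^{n+ϱ} dx < ∞` for some `ϱ > 0`.  The profile of the Gaussian bound decays
faster than any power, so there is no upper restriction on `ϱ`. -/
def MemType {n : ℕ} (g : Rn n → ℂ) : Prop :=
  LocallyIntegrable g volume ∧
    ∃ ϱ : ℝ, 0 < ϱ ∧ ∫⁻ x, ‖g x‖ₑ ^ 2 / ENNReal.ofReal ((1 + ‖x‖) ^ ((n : ℝ) + ϱ)) < ∞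

/-- `m(B)⁻¹ ∫_B |g - e^{-r²L} g|` for the ball `B = B(x₀, r)`. -/
def osc {n : ℕ} (P : ℝ → Rn n → Rn n → ℂ) (g : Rn n → ℂ) (x₀ : Rn n) (r : ℝ) : ℝ≥0∞ :=
  (∫⁻ y in Metric.ball x₀ r, ‖g y - heat P (r ^ 2) g y‖ₑ) / volume (Metric.ball x₀ r)

/-- The sharp maximal function `M^#_L g (x)`: supremum over all balls containing `x`. -/
def sharpMax {n : ℕ} (P : ℝ → Rn n → Rn n → ℂ) (g : Rn n → ℂ) (x : Rn n) : ℝ≥0∞ :=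
  ⨆ (x₀ : Rn n) (r : ℝ) (_ : 0 < r) (_ : x ∈ Metric.ball x₀ r), osc P g x₀ r

/-- `‖g‖_{BMO_L} = ‖M^#_L g‖_{L^∞}`; this is also the norm of `VMO_L`. -/
def bmoNorm {n : ℕ} (P : ℝ → Rn n → Rn n → ℂ) (g : Rn n → ℂ) : ℝ≥0∞ :=
  essSup (sharpMax P g) volume

def MemBMO {n : ℕ} (P : ℝ → Rn n → Rn n → ℂ) (g : Rn n → ℂ) : Prop :=
  MemType g ∧ bmoNorm P g < ∞

/-- The `VMO_L` modulus `η(g; r) = sup_{x₀} m(B)⁻¹ ∫_B |g - e^{-r²L} g|`, `B = B(x₀, r)`. -/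
def vmoModulus {n : ℕ} (P : ℝ → Rn n → Rn n → ℂ) (g : Rn n → ℂ) (r : ℝ) : ℝ≥0∞ :=
  ⨆ x₀ : Rn n, osc P g x₀ r

def MemVMO {n : ℕ} (P : ℝ → Rn n → Rn n → ℂ) (g : Rn n → ℂ) : Prop :=
  MemBMO P g ∧ Tendsto (vmoModulus P g) (𝓝[>] 0) (𝓝 0)

end FracMorrey

end

/-! Write `g = L^{-α/2} f` and `τ = r²`. By Fubini and the semigroup law, `g - e^{-τL} g` is
`Γ(α/2)⁻¹` times the integral of `(e^{-tL} f - e^{-(t+τ)L} f) t^{α/2-1}` over `t > 0`. Hölder's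
inequality and `λ = n - αp` bound the mass of `f` on a ball of radius `s` by a constant times its
Morrey quotient times `s^{n-α}`, so `e^{-tL} f` is pointwise of size `t^{-α/2}`. This alone leaves
`∫ dt/t`, divergent at both ends.

For `t ≤ τ` the divergence disappears after averaging over the ball of radius `r`: by the Gaussian
bound, the mass of `e^{-tL} f` there is at most a constant times `r^{n-α}`, uniformly in `t ≤ r²`.
The term at time `t + τ ≥ τ` is bounded pointwise.

For `t > τ` the increment gains a factor `(τ/t)^{1/2}` (`exists_heat_sub_heat_le_profile`). No
regularity of the kernel in `t` is assumed, so the gain comes from analyticity on `L²`: Schwarz's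
lemma gives `‖T t - T (t + τ)‖ ≤ C τ/t`, and placing this between two smoothing steps `L¹ → L²` and
`L² → L^∞` gives an `L¹ → L^∞` bound. It is applied to `f` cut off to a ball of radius `l √t`; the
remainder is small by the decay of the kernel, and `l` balances the two errors.

The estimates use only an upper bound `Φ` for the mass of `f` on balls, and the mean oscillation at
scale `r` is at most a constant times `r^{α-n} Φ(r)` (`exists_osc_frac_le`). With `Φ` a multiple of
`s^{n-α}` this is the norm inequality; with a small multiple of `s^{n-α}` plus a large multiple of
`s^{n-α+β}` it is the vanishing of the modulus.

Well-definedness splits the time integral at `1`: short times need only the growth bound, long times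
are compared with the Riesz potential at one point. Membership in the class `𝓜` follows by writing
`g` as `(g - e^{-L} g) + e^{-L} g` and applying Cauchy–Schwarz in time to the short-time part. -/

noncomputable section

namespace FracMorrey

open scoped NNReal

/-! ### Polynomially decaying weights -/

/-- The weight `(1 + |x - y| / ρ)^{-N}`. -/
def decay {n : ℕ} (N : ℕ) (ρ : ℝ) (x y : Rn n) : ℝ≥0∞ :=
  ENNReal.ofReal (((1 + ‖x - y‖ / ρ) ^ N)⁻¹)

section decay
variable {n : ℕ}

theorem measurable_decay_right (N : ℕ) (ρ : ℝ) (x : Rn n) : Measurable (decay N ρ x) := by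
  unfold decay; fun_prop

theorem measurable_decay_left (N : ℕ) (ρ : ℝ) (y : Rn n) :
    Measurable (fun x : Rn n => decay N ρ x y) := by
  unfold decay; fun_prop

theorem decay_comm (N : ℕ) (ρ : ℝ) (x y : Rn n) : decay N ρ x y = decay N ρ y x := by
  unfold decay; rw [norm_sub_rev]

theorem decay_add (N K : ℕ) {ρ : ℝ} (hρ : 0 < ρ) (x y : Rn n) :
    decay (N + K) ρ x y = decay N ρ x y * decay K ρ x y := by
  unfold decay
  rw [← ENNReal.ofReal_mul (by positivity), pow_add, mul_inv]

theorem decay_le_one (N : ℕ) {ρ : ℝ} (hρ : 0 < ρ) (x y : Rn n) : decay N ρ x y ≤ 1 := by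
  unfold decay
  rw [ENNReal.ofReal_le_one]
  apply inv_le_one_of_one_le₀
  apply one_le_pow₀
  have : 0 ≤ ‖x - y‖ / ρ := by positivity
  linarith

theorem decay_anti {N K : ℕ} (h : N ≤ K) {ρ : ℝ} (hρ : 0 < ρ) (x y : Rn n) :
    decay K ρ x y ≤ decay N ρ x y := by
  obtain ⟨J, rfl⟩ := Nat.exists_eq_add_of_le h
  rw [decay_add _ _ hρ]
  exact mul_le_of_le_one_right' (decay_le_one _ hρ _ _)

theorem decay_mono_radius (N : ℕ) {σ ρ : ℝ} (hσ : 0 < σ) (h : σ ≤ ρ) (x y : Rn n) :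
    decay N σ x y ≤ decay N ρ x y := by
  have hρ : 0 < ρ := hσ.trans_le h
  unfold decay
  gcongr

/-- Changing the radius by a factor at most `2`. -/
theorem decay_two_mul_le (N : ℕ) {σ ρ : ℝ} (hσ : 0 < σ) (h : ρ ≤ 2 * σ) (hρ : 0 < ρ) (x y : Rn n) :
    decay N ρ x y ≤ 2 ^ N * decay N σ x y := by
  unfold decay
  rw [show (2 : ℝ≥0∞) ^ N = ENNReal.ofReal (2 ^ N) by
    rw [ENNReal.ofReal_pow (by norm_num)]; simp, ← ENNReal.ofReal_mul (by positivity)]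
  apply ENNReal.ofReal_le_ofReal
  rw [← div_eq_mul_inv, inv_eq_one_div, div_le_div_iff₀ (by positivity) (by positivity), one_mul,
    ← mul_pow]
  apply pow_le_pow_left₀ (by positivity)
  have h1 : ‖x - y‖ / (2 * σ) ≤ ‖x - y‖ / ρ := by gcongr
  have h2 : ‖x - y‖ / σ = 2 * (‖x - y‖ / (2 * σ)) := by field_simp
  rw [h2]; linarith

/-- The triangle inequality together with `1 + a + b ≤ (1 + a)(1 + b)`. This is what allows the
centre of a weight to be moved. -/
theorem decay_mul_decay_le (N : ℕ) {ρ : ℝ} (hρ : 0 < ρ) (x y z : Rn n) :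
    decay N ρ x y * decay N ρ y z ≤ decay N ρ x z := by
  unfold decay
  rw [← ENNReal.ofReal_mul (by positivity), ← mul_inv, ← mul_pow]
  apply ENNReal.ofReal_le_ofReal
  apply inv_anti₀ (by positivity)
  apply pow_le_pow_left₀ (by positivity)
  have h1 : ‖x - z‖ / ρ ≤ ‖x - y‖ / ρ + ‖y - z‖ / ρ := by
    rw [← add_div]; gcongr
    exact norm_sub_le_norm_sub_add_norm_sub x y z
  have h2 : 0 ≤ ‖x - y‖ / ρ * (‖y - z‖ / ρ) := by positivity
  nlinarith

theorem one_le_decay_of_mem_ball (N : ℕ) {ρ : ℝ} (hρ : 0 < ρ) {x₀ x : Rn n}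
    (hx : x ∈ Metric.ball x₀ ρ) : 1 ≤ 2 ^ N * decay N ρ x₀ x := by
  unfold decay
  rw [show (2 : ℝ≥0∞) ^ N = ENNReal.ofReal (2 ^ N) by
    rw [ENNReal.ofReal_pow (by norm_num)]; simp, ← ENNReal.ofReal_mul (by positivity),
    ENNReal.one_le_ofReal, ← div_eq_mul_inv, one_le_div (by positivity)]
  apply pow_le_pow_left₀ (by positivity)
  have : ‖x₀ - x‖ / ρ ≤ 1 := by
    rw [div_le_one hρ, ← dist_eq_norm, dist_comm]; exact hx.le
  linarith

/-- Moving the centre within a ball of the same radius. -/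
theorem decay_le_of_mem_ball (N : ℕ) {ρ : ℝ} (hρ : 0 < ρ) {x₀ x : Rn n}
    (hx : x ∈ Metric.ball x₀ ρ) (y : Rn n) : decay N ρ x y ≤ 2 ^ N * decay N ρ x₀ y :=
  calc decay N ρ x y = 1 * decay N ρ x y := (one_mul _).symm
    _ ≤ (2 ^ N * decay N ρ x₀ x) * decay N ρ x y := by
        gcongr; exact one_le_decay_of_mem_ball N hρ hx
    _ ≤ 2 ^ N * decay N ρ x₀ y := by
        rw [mul_assoc]; gcongr; exact decay_mul_decay_le N hρ _ _ _

theorem decay_ne_top (N : ℕ) (ρ : ℝ) (x y : Rn n) : decay N ρ x y ≠ ⊤ := ENNReal.ofReal_ne_top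

/-- One term suffices: for the least `k` with `‖x - y‖ < 2^k ρ`, minimality gives `2^k ≤ 2 (1 + ‖x -
y‖ / ρ)`. -/
theorem decay_le_tsum_indicator (N : ℕ) {ρ : ℝ} (hρ : 0 < ρ) (x y : Rn n) :
    decay N ρ x y ≤ ∑' k : ℕ, 2 ^ N * ENNReal.ofReal (((2 : ℝ) ^ (k * N))⁻¹) *
      (Metric.ball x (2 ^ k * ρ)).indicator 1 y := by
  set d := ‖x - y‖ / ρ with hd
  have hd0 : 0 ≤ d := by positivity
  have hex : ∃ k : ℕ, d < 2 ^ k := pow_unbounded_of_one_lt d one_lt_two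
  classical
  set k := Nat.find hex with hk
  have hk1 : d < 2 ^ k := Nat.find_spec hex
  have hk2 : (2 : ℝ) ^ k ≤ 2 * (1 + d) := by
    rcases Nat.eq_zero_or_pos k with h0 | hpos
    · rw [h0]; simp; linarith
    · have := Nat.find_min hex (m := k - 1) (by omega)
      rw [not_lt] at this
      have e : (2 : ℝ) ^ k = 2 * 2 ^ (k - 1) := by
        rw [← pow_succ']; congr 1; omega
      rw [e]; linarith
  refine le_trans ?_ (ENNReal.le_tsum k)
  have hy : y ∈ Metric.ball x (2 ^ k * ρ) := by
    rw [Metric.mem_ball, dist_comm, dist_eq_norm]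
    rwa [hd, div_lt_iff₀ hρ] at hk1
  rw [indicator_of_mem hy, Pi.one_apply, mul_one]
  unfold decay
  rw [show (2 : ℝ≥0∞) ^ N = ENNReal.ofReal (2 ^ N) by
    rw [ENNReal.ofReal_pow (by norm_num)]; simp, ← ENNReal.ofReal_mul (by positivity)]
  apply ENNReal.ofReal_le_ofReal
  rw [← div_eq_mul_inv, inv_eq_one_div, div_le_div_iff₀ (by positivity) (by positivity), one_mul,
    ← mul_pow, pow_mul]
  exact pow_le_pow_left₀ (by positivity) hk2 N

end decay

/-! ### Densities with controlled mass on balls -/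

/-- The mass of `F` on balls of radius `s` is at most `Φ s`, where `Φ s / s ^ n` is nonincreasing. -/
structure BallGrowth {n : ℕ} (F : Rn n → ℝ≥0∞) (Φ : ℝ → ℝ≥0∞) : Prop where
  lt_top : ∀ s, 0 < s → Φ s < ⊤
  scale : ∀ s, 0 < s → ∀ l : ℝ, 1 ≤ l → Φ (l * s) ≤ ENNReal.ofReal (l ^ n) * Φ s
  ball : ∀ x s, 0 < s → ∫⁻ y in Metric.ball x s, F y ≤ Φ s

section growth
variable {n : ℕ} {F : Rn n → ℝ≥0∞} {Φ : ℝ → ℝ≥0∞}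

/-- The dyadic ball of radius `2^k ρ` carries mass at most `2^{kn} Φ(ρ)` against the weight
`2^{-k(n+1)}`; the one power beyond `n` makes the series geometric. -/
theorem BallGrowth.lintegral_decay_le (h : BallGrowth F Φ) (hF : Measurable F) {ρ : ℝ}
    (hρ : 0 < ρ) (x : Rn n) :
    ∫⁻ y, F y * decay (n + 1) ρ x y ≤ 2 ^ (n + 2) * Φ ρ := by
  have hmeas : ∀ k : ℕ, MeasurableSet (Metric.ball x (2 ^ k * ρ)) := fun k => measurableSet_ball
  calc ∫⁻ y, F y * decay (n + 1) ρ x y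
      ≤ ∫⁻ y, ∑' k : ℕ, F y * (2 ^ (n + 1) * ENNReal.ofReal (((2 : ℝ) ^ (k * (n + 1)))⁻¹) *
          (Metric.ball x (2 ^ k * ρ)).indicator 1 y) := by
        apply lintegral_mono; intro y
        simp only [ENNReal.tsum_mul_left]
        gcongr
        exact decay_le_tsum_indicator (n + 1) hρ x y
    _ = ∑' k : ℕ, 2 ^ (n + 1) * ENNReal.ofReal (((2 : ℝ) ^ (k * (n + 1)))⁻¹) *
          ∫⁻ y in Metric.ball x (2 ^ k * ρ), F y := by
        rw [lintegral_tsum]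
        · congr 1; ext k
          rw [← lintegral_indicator (hmeas k), ← lintegral_const_mul _ (hF.indicator (hmeas k))]
          congr 1; ext y
          by_cases hy : y ∈ Metric.ball x (2 ^ k * ρ)
          · simp only [indicator_of_mem hy, Pi.one_apply]; ring
          · simp only [indicator_of_notMem hy]; ring
        · intro k
          exact (hF.mul ((measurable_one.indicator (hmeas k)).const_mul _)).aemeasurable
    _ ≤ ∑' k : ℕ, (2 ^ (n + 1) * Φ ρ) * (2⁻¹ : ℝ≥0∞) ^ k := by
        apply ENNReal.tsum_le_tsum; intro k
        have h1 := (h.ball x (2 ^ k * ρ) (by positivity)).trans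
          (h.scale ρ hρ (2 ^ k) (one_le_pow₀ one_le_two))
        calc _ ≤ 2 ^ (n + 1) * ENNReal.ofReal (((2 : ℝ) ^ (k * (n + 1)))⁻¹) *
              (ENNReal.ofReal ((2 ^ k) ^ n) * Φ ρ) := by gcongr
          _ = (2 ^ (n + 1) * Φ ρ) * (ENNReal.ofReal (((2 : ℝ) ^ (k * (n + 1)))⁻¹) *
              ENNReal.ofReal ((2 ^ k) ^ n)) := by ring
          _ = _ := by
            congr 1
            rw [← ENNReal.ofReal_mul (by positivity),
              show ((2 : ℝ) ^ (k * (n + 1)))⁻¹ * (2 ^ k) ^ n = (2⁻¹) ^ k by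
                rw [← pow_mul, mul_add, pow_add, inv_pow, mul_one]; field_simp,
              ENNReal.ofReal_pow (by norm_num), ENNReal.ofReal_inv_of_pos (by norm_num)]
            simp
    _ = 2 ^ (n + 2) * Φ ρ := by
        rw [ENNReal.tsum_mul_left, ENNReal.tsum_geometric, ENNReal.one_sub_inv_two, inv_inv]
        ring

end growth

/-- Lebesgue measure of balls, as a growth function. -/
theorem ballGrowth_volume (n : ℕ) :
    BallGrowth (fun _ : Rn n => 1)
      (fun s => ENNReal.ofReal (s ^ n) * volume (Metric.ball (0 : Rn n) 1)) where
  lt_top s hs := ENNReal.mul_lt_top ENNReal.ofReal_lt_top measure_ball_lt_top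
  scale s hs l hl := by
    rw [mul_pow, ENNReal.ofReal_mul (by positivity), mul_assoc]
  ball x s hs := by
    rw [lintegral_one, Measure.restrict_apply_univ, Measure.addHaar_ball_of_pos _ _ hs]
    simp

theorem lintegral_decay_le (n : ℕ) : ∃ C : ℝ≥0, ∀ ρ : ℝ, 0 < ρ → ∀ y : Rn n,
    ∫⁻ x, decay (n + 1) ρ x y ≤ C * ENNReal.ofReal (ρ ^ n) := by
  have hfin : volume (Metric.ball (0 : Rn n) 1) ≠ ⊤ := measure_ball_lt_top.ne
  refine ⟨2 ^ (n + 2) * (volume (Metric.ball (0 : Rn n) 1)).toNNReal, fun ρ hρ y => ?_⟩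
  have := (ballGrowth_volume n).lintegral_decay_le measurable_const hρ y
  simp only [one_mul] at this
  simp only [decay_comm _ _ _ y]
  refine this.trans (le_of_eq ?_)
  push_cast
  rw [ENNReal.coe_toNNReal hfin]; ring

/-! ### Power integrals -/

theorem lintegral_Ioi_rpow {a c : ℝ} (ha : a < -1) (hc : 0 < c) :
    ∫⁻ t in Ioi c, ENNReal.ofReal (t ^ a) = ENNReal.ofReal (-c ^ (a + 1) / (a + 1)) := by
  rw [← integral_Ioi_rpow_of_lt ha hc, ofReal_integral_eq_lintegral_ofReal]
  · exact integrableOn_Ioi_rpow_of_lt ha hc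
  · filter_upwards [ae_restrict_mem measurableSet_Ioi] with t ht
    exact Real.rpow_nonneg (hc.trans ht).le _

theorem lintegral_Ioc_rpow {a c : ℝ} (ha : -1 < a) (hc : 0 < c) :
    ∫⁻ t in Ioc 0 c, ENNReal.ofReal (t ^ a) = ENNReal.ofReal (c ^ (a + 1) / (a + 1)) := by
  have h1 : IntervalIntegrable (fun t : ℝ => t ^ a) volume 0 c :=
    intervalIntegral.intervalIntegrable_rpow' ha
  have h2 := integral_rpow (a := 0) (b := c) (Or.inl ha)
  rw [Real.zero_rpow (by linarith), sub_zero] at h2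
  rw [← h2, intervalIntegral.integral_of_le hc.le, ofReal_integral_eq_lintegral_ofReal]
  · exact (intervalIntegrable_iff_integrableOn_Ioc_of_le hc.le).1 h1
  · filter_upwards [ae_restrict_mem measurableSet_Ioc] with t ht
    exact Real.rpow_nonneg ht.1.le _

/-! ### Kernel bounds -/

/-- Since `(1 + s)^M ≤ M! e^{1+s}`, it remains to complete the square in `1 + s - A s²`. Henceforth
the Gaussian enters only through polynomial decay of whatever order is convenient. -/
theorem exists_exp_neg_mul_sq_le (M : ℕ) {A : ℝ} (hA : 0 < A) :
    ∃ C : ℝ, 0 < C ∧ ∀ s : ℝ, 0 ≤ s → Real.exp (-A * s ^ 2) ≤ C * ((1 + s) ^ M)⁻¹ := by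
  refine ⟨M.factorial * Real.exp (1 + 1 / (4 * A)), by positivity, fun s hs => ?_⟩
  rw [← div_eq_mul_inv, le_div_iff₀ (by positivity)]
  have h1 := Real.pow_div_factorial_le_exp (1 + s) (by positivity) M
  rw [div_le_iff₀ (by positivity)] at h1
  calc Real.exp (-A * s ^ 2) * (1 + s) ^ M
      ≤ Real.exp (-A * s ^ 2) * (Real.exp (1 + s) * M.factorial) := by gcongr
    _ = M.factorial * Real.exp (-A * s ^ 2 + (1 + s)) := by
      rw [Real.exp_add (-A * s ^ 2)]; ring
    _ ≤ _ := by
      apply mul_le_mul_of_nonneg_left _ (by positivity)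
      apply Real.exp_le_exp.2
      have : -A * s ^ 2 + (1 + s) = 1 + 1 / (4 * A) - A * (s - 1 / (2 * A)) ^ 2 := by
        field_simp; ring
      rw [this]
      have : 0 ≤ A * (s - 1 / (2 * A)) ^ 2 := by positivity
      linarith

/-- A kernel bounded by `C t^{-n/2} (1 + |x - y| / √t)^{-M}`. -/
def PolyBound {n : ℕ} (P : ℝ → Rn n → Rn n → ℂ) (M : ℕ) (C : ℝ≥0) : Prop :=
  ∀ t : ℝ, 0 < t → ∀ x y : Rn n,
    ‖P t x y‖ₑ ≤ C * ENNReal.ofReal (t ^ (-((n : ℝ) / 2))) * decay M (√t) x y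

theorem GaussianBound.exists_polyBound {n : ℕ} {P : ℝ → Rn n → Rn n → ℂ} (hG : GaussianBound P)
    (M : ℕ) : ∃ C : ℝ≥0, PolyBound P M C := by
  obtain ⟨C, A, hC, hA, h⟩ := hG
  obtain ⟨D, hD, hexp⟩ := exists_exp_neg_mul_sq_le M hA
  refine ⟨(C * D).toNNReal, fun t ht x y => ?_⟩
  change _ ≤ ENNReal.ofReal (C * D) * _ * ENNReal.ofReal _
  rw [← ofReal_norm, ← ENNReal.ofReal_mul (by positivity),
    ← ENNReal.ofReal_mul (by positivity)]
  apply ENNReal.ofReal_le_ofReal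
  refine (h t ht x y).trans ?_
  have e : ‖x - y‖ ^ 2 / t = (‖x - y‖ / √t) ^ 2 := by
    rw [div_pow, Real.sq_sqrt ht.le]
  rw [e, Real.rpow_neg ht.le]
  calc _ ≤ C / t ^ ((n : ℝ) / 2) * (D * ((1 + ‖x - y‖ / √t) ^ M)⁻¹) := by
        gcongr; exact hexp _ (by positivity)
    _ = _ := by ring

theorem PolyBound.mono {n : ℕ} {P : ℝ → Rn n → Rn n → ℂ} {M K : ℕ} {C : ℝ≥0}
    (h : PolyBound P M C) (hK : K ≤ M) : PolyBound P K C := fun t ht x y =>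
  (h t ht x y).trans (by gcongr; exact decay_anti hK (Real.sqrt_pos.2 ht) x y)

theorem sqrt_pow_eq {n : ℕ} {t : ℝ} (ht : 0 < t) : (√t) ^ n = t ^ ((n : ℝ) / 2) := by
  rw [Real.sqrt_eq_rpow, ← Real.rpow_natCast, ← Real.rpow_mul ht.le]; congr 1; ring

theorem ofReal_rpow_neg_mul_sqrt_pow (n : ℕ) {t : ℝ} (ht : 0 < t) :
    ENNReal.ofReal (t ^ (-((n : ℝ) / 2))) * ENNReal.ofReal ((√t) ^ n) = 1 := by
  rw [← ENNReal.ofReal_mul (by positivity), sqrt_pow_eq ht, ← Real.rpow_add ht]; simp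

/-! ### The heat operator on functions of controlled growth -/

/-- The integral operator with kernel `|P t|` applied to `|f|`. -/
def absHeat {n : ℕ} (P : ℝ → Rn n → Rn n → ℂ) (t : ℝ) (f : Rn n → ℂ) (x : Rn n) : ℝ≥0∞ :=
  ∫⁻ y, ‖P t x y‖ₑ * ‖f y‖ₑ

/-- `t^{-n/2} Φ(√t)`. -/
def profile (n : ℕ) (Φ : ℝ → ℝ≥0∞) (t : ℝ) : ℝ≥0∞ :=
  ENNReal.ofReal (t ^ (-((n : ℝ) / 2))) * Φ (√t)

section heat
variable {n : ℕ} {P : ℝ → Rn n → Rn n → ℂ} {f : Rn n → ℂ} {Φ : ℝ → ℝ≥0∞} {M : ℕ} {C : ℝ≥0}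

/-- A restatement of the scaling axiom: `Φ(ρ) / ρ^n` is nonincreasing, evaluated at `ρ = √t`. -/
theorem profile_anti {F : Rn n → ℝ≥0∞} (h : BallGrowth F Φ) {s t : ℝ} (hs : 0 < s) (hst : s ≤ t) :
    profile n Φ t ≤ profile n Φ s := by
  have ht : 0 < t := hs.trans_le hst
  have h1 := h.scale (√s) (Real.sqrt_pos.2 hs) (√t / √s)
    ((one_le_div (Real.sqrt_pos.2 hs)).2 (Real.sqrt_le_sqrt hst))
  rw [div_mul_cancel₀ _ (Real.sqrt_pos.2 hs).ne'] at h1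
  unfold profile
  calc _ ≤ ENNReal.ofReal (t ^ (-((n : ℝ) / 2))) * (ENNReal.ofReal ((√t / √s) ^ n) * Φ (√s)) := by
        gcongr
    _ = _ := by
        rw [← mul_assoc, ← ENNReal.ofReal_mul (by positivity), div_pow, sqrt_pow_eq ht,
          sqrt_pow_eq hs, ← mul_div_assoc, ← Real.rpow_add ht, neg_add_cancel,
          Real.rpow_zero, one_div, Real.rpow_neg hs.le]

theorem profile_lt_top {F : Rn n → ℝ≥0∞} (h : BallGrowth F Φ) {t : ℝ} (ht : 0 < t) :
    profile n Φ t < ⊤ :=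
  ENNReal.mul_lt_top ENNReal.ofReal_lt_top (h.lt_top _ (Real.sqrt_pos.2 ht))

theorem enorm_heat_le (t : ℝ) (x : Rn n) : ‖heat P t f x‖ₑ ≤ absHeat P t f x := by
  refine (enorm_integral_le_lintegral_enorm _).trans (le_of_eq ?_)
  simp only [enorm_mul]; rfl

theorem measurable_kernel_right
    (hP : Measurable (fun q : ℝ × Rn n × Rn n => P q.1 q.2.1 q.2.2)) (t : ℝ) (x : Rn n) :
    Measurable (P t x) :=
  hP.comp (measurable_const.prodMk (measurable_const.prodMk measurable_id))

theorem measurable_kernel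
    (hP : Measurable (fun q : ℝ × Rn n × Rn n => P q.1 q.2.1 q.2.2)) (t : ℝ) :
    Measurable (fun q : Rn n × Rn n => P t q.1 q.2) :=
  hP.comp (measurable_const.prodMk measurable_id)

theorem measurable_heat_prod
    (hP : Measurable (fun q : ℝ × Rn n × Rn n => P q.1 q.2.1 q.2.2)) (hf : Measurable f) :
    Measurable (fun q : ℝ × Rn n => heat P q.1 f q.2) := by
  have h : Measurable (fun q : (ℝ × Rn n) × Rn n => P q.1.1 q.1.2 q.2 * f q.2) := by
    apply Measurable.mul _ (hf.comp measurable_snd)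
    exact hP.comp (f := fun q : (ℝ × Rn n) × Rn n => (q.1.1, q.1.2, q.2)) (by fun_prop)
  exact (h.stronglyMeasurable.integral_prod_right (ν := volume)).measurable

theorem measurable_absHeat_prod
    (hP : Measurable (fun q : ℝ × Rn n × Rn n => P q.1 q.2.1 q.2.2)) (hf : Measurable f) :
    Measurable (fun q : ℝ × Rn n => absHeat P q.1 f q.2) := by
  have h : Measurable (fun q : (ℝ × Rn n) × Rn n => ‖P q.1.1 q.1.2 q.2‖ₑ * ‖f q.2‖ₑ) := by
    apply Measurable.mul _ (hf.comp measurable_snd).enorm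
    exact (hP.comp (f := fun q : (ℝ × Rn n) × Rn n => (q.1.1, q.1.2, q.2)) (by fun_prop)).enorm
  exact h.lintegral_prod_right

theorem measurable_heat
    (hP : Measurable (fun q : ℝ × Rn n × Rn n => P q.1 q.2.1 q.2.2)) (hf : Measurable f) (t : ℝ) :
    Measurable (heat P t f) :=
  (measurable_heat_prod hP hf).comp (measurable_const.prodMk measurable_id)

theorem measurable_absHeat
    (hP : Measurable (fun q : ℝ × Rn n × Rn n => P q.1 q.2.1 q.2.2)) (hf : Measurable f) (t : ℝ) :
    Measurable (absHeat P t f) :=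
  (measurable_absHeat_prod hP hf).comp (measurable_const.prodMk measurable_id)

/-- Pointwise bound for the heat operator. -/
theorem absHeat_le (hK : PolyBound P (n + 1) C) (hf : Measurable f)
    (hΦ : BallGrowth (fun y => ‖f y‖ₑ) Φ) {t : ℝ} (ht : 0 < t) (x : Rn n) :
    absHeat P t f x ≤ C * 2 ^ (n + 2) * profile n Φ t := by
  have hd := hΦ.lintegral_decay_le hf.enorm (Real.sqrt_pos.2 ht) x
  calc absHeat P t f x
      ≤ ∫⁻ y, (C * ENNReal.ofReal (t ^ (-((n : ℝ) / 2)))) * (‖f y‖ₑ * decay (n + 1) (√t) x y) := by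
        apply lintegral_mono; intro y
        calc ‖P t x y‖ₑ * ‖f y‖ₑ
            ≤ (C * ENNReal.ofReal (t ^ (-((n : ℝ) / 2))) * decay (n + 1) (√t) x y) * ‖f y‖ₑ := by
              gcongr; exact hK t ht x y
          _ = _ := by ring
    _ = (C * ENNReal.ofReal (t ^ (-((n : ℝ) / 2)))) * ∫⁻ y, ‖f y‖ₑ * decay (n + 1) (√t) x y :=
        lintegral_const_mul _ (hf.enorm.mul (measurable_decay_right _ _ _))
    _ ≤ (C * ENNReal.ofReal (t ^ (-((n : ℝ) / 2)))) * (2 ^ (n + 2) * Φ (√t)) := by gcongr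
    _ = _ := by unfold profile; ring

theorem absHeat_le_lintegral (hK : PolyBound P 0 C) {t : ℝ} (ht : 0 < t) (x : Rn n) :
    absHeat P t f x ≤ C * ENNReal.ofReal (t ^ (-((n : ℝ) / 2))) * ∫⁻ y, ‖f y‖ₑ := by
  rw [← lintegral_const_mul' _ _ (ENNReal.mul_ne_top ENNReal.coe_ne_top ENNReal.ofReal_ne_top)]
  apply lintegral_mono; intro y
  dsimp only
  gcongr
  refine (hK t ht x y).trans (mul_le_of_le_one_right' (decay_le_one _ (Real.sqrt_pos.2 ht) _ _))

/-- The heat kernel has uniformly bounded mass in the first variable against a weight. -/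
theorem exists_lintegral_kernel_mul_decay_le (hK : PolyBound P (2 * n + 2) C) :
    ∃ D : ℝ≥0, ∀ t ρ : ℝ, 0 < t → √t ≤ ρ → ∀ x₀ y : Rn n,
      ∫⁻ x, ‖P t x y‖ₑ * decay (n + 1) ρ x₀ x ≤ D * decay (n + 1) ρ x₀ y := by
  obtain ⟨D, hD⟩ := lintegral_decay_le n
  refine ⟨C * D, fun t ρ ht hρ x₀ y => ?_⟩
  have hst := Real.sqrt_pos.2 ht
  calc ∫⁻ x, ‖P t x y‖ₑ * decay (n + 1) ρ x₀ x
      ≤ ∫⁻ x, (C * ENNReal.ofReal (t ^ (-((n : ℝ) / 2))) * decay (n + 1) ρ x₀ y) *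
          decay (n + 1) (√t) x y := by
        apply lintegral_mono; intro x
        have h1 := hK t ht x y
        -- Half of the decay transports the weight from `x` to `y`; the other half is integrable in
        -- `x`.
        rw [show 2 * n + 2 = (n + 1) + (n + 1) by ring, decay_add _ _ hst] at h1
        calc ‖P t x y‖ₑ * decay (n + 1) ρ x₀ x
            ≤ (C * ENNReal.ofReal (t ^ (-((n : ℝ) / 2))) *
              (decay (n + 1) ρ x y * decay (n + 1) (√t) x y)) * decay (n + 1) ρ x₀ x := by
              gcongr
              refine h1.trans ?_
              gcongr
              exact decay_mono_radius _ hst hρ x y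
          _ = C * ENNReal.ofReal (t ^ (-((n : ℝ) / 2))) *
              (decay (n + 1) ρ x₀ x * decay (n + 1) ρ x y) * decay (n + 1) (√t) x y := by ring
          _ ≤ _ := by dsimp only; gcongr; exact decay_mul_decay_le _ (hst.trans_le hρ) _ _ _
    _ = (C * ENNReal.ofReal (t ^ (-((n : ℝ) / 2))) * decay (n + 1) ρ x₀ y) *
          ∫⁻ x, decay (n + 1) (√t) x y :=
        lintegral_const_mul _ (measurable_decay_left _ _ _)
    _ ≤ (C * ENNReal.ofReal (t ^ (-((n : ℝ) / 2))) * decay (n + 1) ρ x₀ y) *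
          (D * ENNReal.ofReal ((√t) ^ n)) := by gcongr; exact hD _ hst y
    _ = (C * D * decay (n + 1) ρ x₀ y) * (ENNReal.ofReal (t ^ (-((n : ℝ) / 2))) *
          ENNReal.ofReal ((√t) ^ n)) := by ring
    _ = _ := by rw [ofReal_rpow_neg_mul_sqrt_pow n ht]; push_cast; ring

/-- Weighted `L¹` bound for the heat operator. -/
theorem exists_lintegral_absHeat_mul_decay_le
    (hP : Measurable (fun q : ℝ × Rn n × Rn n => P q.1 q.2.1 q.2.2))
    (hK : PolyBound P (2 * n + 2) C) :
    ∃ D : ℝ≥0, ∀ (f : Rn n → ℂ), Measurable f → ∀ t ρ : ℝ, 0 < t → √t ≤ ρ → ∀ x₀ : Rn n,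
      ∫⁻ x, absHeat P t f x * decay (n + 1) ρ x₀ x ≤
        D * ∫⁻ y, ‖f y‖ₑ * decay (n + 1) ρ x₀ y := by
  obtain ⟨D, hD⟩ := exists_lintegral_kernel_mul_decay_le hK
  refine ⟨D, fun f hf t ρ ht hρ x₀ => ?_⟩
  calc ∫⁻ x, absHeat P t f x * decay (n + 1) ρ x₀ x
      = ∫⁻ x, ∫⁻ y, ‖f y‖ₑ * (‖P t x y‖ₑ * decay (n + 1) ρ x₀ x) := by
        apply lintegral_congr; intro x
        unfold absHeat
        rw [← lintegral_mul_const' _ _ (decay_ne_top _ _ _ _)]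
        apply lintegral_congr; intro y; ring
    _ = ∫⁻ y, ∫⁻ x, ‖f y‖ₑ * (‖P t x y‖ₑ * decay (n + 1) ρ x₀ x) := by
        apply lintegral_lintegral_swap
        apply Measurable.aemeasurable
        apply (hf.comp measurable_snd).enorm.mul
        exact (measurable_kernel hP t).enorm.mul
          ((measurable_decay_right _ _ x₀).comp measurable_fst)
    _ ≤ ∫⁻ y, D * (‖f y‖ₑ * decay (n + 1) ρ x₀ y) := by
        apply lintegral_mono; intro y
        dsimp only
        rw [lintegral_const_mul' _ _ enorm_ne_top]
        calc _ ≤ ‖f y‖ₑ * (D * decay (n + 1) ρ x₀ y) := by gcongr; exact hD t ρ ht hρ x₀ y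
          _ = _ := by ring
    _ = _ := lintegral_const_mul _ (hf.enorm.mul (measurable_decay_right _ _ _))

/-- The indicator of the ball is dominated by the weight centred at `x₀`, for which the heat
operator is bounded on weighted `L¹`. The bound is uniform over all `t ≤ ρ²`, which is what makes
short times summable after averaging. -/
theorem exists_setLIntegral_absHeat_le
    (hP : Measurable (fun q : ℝ × Rn n × Rn n => P q.1 q.2.1 q.2.2))
    (hK : PolyBound P (2 * n + 2) C) :
    ∃ D : ℝ≥0, ∀ (f : Rn n → ℂ) (Φ : ℝ → ℝ≥0∞), Measurable f →
      BallGrowth (fun y => ‖f y‖ₑ) Φ → ∀ t ρ : ℝ, 0 < t → √t ≤ ρ → ∀ x₀ : Rn n,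
      ∫⁻ x in Metric.ball x₀ ρ, absHeat P t f x ≤ D * Φ ρ := by
  obtain ⟨D, hD⟩ := exists_lintegral_absHeat_mul_decay_le hP hK
  refine ⟨2 ^ (n + 1) * (D * 2 ^ (n + 2)), fun f Φ hf hΦ t ρ ht hρ x₀ => ?_⟩
  have hρ0 : 0 < ρ := (Real.sqrt_pos.2 ht).trans_le hρ
  have hm : Measurable (fun x => absHeat P t f x * decay (n + 1) ρ x₀ x) :=
    (measurable_absHeat hP hf t).mul (measurable_decay_right (n + 1) ρ x₀)
  calc ∫⁻ x in Metric.ball x₀ ρ, absHeat P t f x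
      ≤ ∫⁻ x in Metric.ball x₀ ρ, 2 ^ (n + 1) * (absHeat P t f x * decay (n + 1) ρ x₀ x) := by
        apply setLIntegral_mono (hm.const_mul _)
        intro x hx
        calc absHeat P t f x = absHeat P t f x * 1 := (mul_one _).symm
          _ ≤ absHeat P t f x * (2 ^ (n + 1) * decay (n + 1) ρ x₀ x) := by
              gcongr; exact one_le_decay_of_mem_ball _ hρ0 hx
          _ = _ := by ring
    _ ≤ ∫⁻ x, 2 ^ (n + 1) * (absHeat P t f x * decay (n + 1) ρ x₀ x) := setLIntegral_le_lintegral _ _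
    _ = 2 ^ (n + 1) * ∫⁻ x, absHeat P t f x * decay (n + 1) ρ x₀ x := lintegral_const_mul _ hm
    _ ≤ 2 ^ (n + 1) * (D * (2 ^ (n + 2) * Φ ρ)) := by
        gcongr
        refine (hD f hf t ρ ht hρ x₀).trans ?_
        gcongr
        exact hΦ.lintegral_decay_le hf.enorm hρ0 x₀
    _ = _ := by push_cast; ring

end heat

/-! ### Analytic semigroups -/

theorem ofReal_mem_sector {θ t : ℝ} (hθ : 0 < θ) (ht : 0 < t) : (t : ℂ) ∈ sector θ := by
  refine ⟨by exact_mod_cast ht.ne', ?_⟩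
  rw [Complex.arg_ofReal_of_nonneg ht.le, abs_zero]; exact hθ

/-- Continuity of the argument at `1` gives a disc for `t = 1`; the sector is invariant under
positive dilations. -/
theorem exists_ball_subset_sector {θ : ℝ} (hθ : 0 < θ) :
    ∃ c : ℝ, 0 < c ∧ ∀ t : ℝ, 0 < t → Metric.ball (t : ℂ) (c * t) ⊆ sector θ := by
  have h1 : ∀ᶠ z in 𝓝 (1 : ℂ), z ∈ sector θ := by
    have hc : ContinuousAt (fun z : ℂ => |z.arg|) 1 :=
      (Complex.continuousAt_arg Complex.one_mem_slitPlane).abs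
    have h2 : ∀ᶠ z in 𝓝 (1 : ℂ), |z.arg| < θ := by
      apply hc.eventually_lt_const
      simpa using hθ
    filter_upwards [h2, eventually_ne_nhds one_ne_zero] with z hz hz0 using ⟨hz0, hz⟩
  obtain ⟨c, hc, hball⟩ := Metric.eventually_nhds_iff_ball.1 h1
  refine ⟨c, hc, fun t ht z hz => ?_⟩
  have ht' : (t : ℂ) ≠ 0 := by exact_mod_cast ht.ne'
  have hw : z / t ∈ Metric.ball (1 : ℂ) c := by
    rw [Metric.mem_ball, dist_eq_norm] at hz ⊢
    rw [show z / t - 1 = (z - t) / t by field_simp, norm_div, Complex.norm_real,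
      Real.norm_of_nonneg ht.le, div_lt_iff₀ ht]
    exact hz
  obtain ⟨h3, h4⟩ := hball _ hw
  have e : z = (t : ℂ) * (z / t) := by field_simp
  refine ⟨fun h0 => h3 (by rw [h0, zero_div]), ?_⟩
  rw [e, Complex.arg_real_mul _ ht]; exact h4

theorem IsBoundedAnalyticSemigroup.add {E : Type*} [NormedAddCommGroup E] [NormedSpace ℂ E]
    {T : ℝ → E →L[ℂ] E} (hT : IsBoundedAnalyticSemigroup T) {s t : ℝ} (hs : 0 < s) (ht : 0 < t) :
    T (s + t) = (T s).comp (T t) := by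
  obtain ⟨θ, hθ, -, S, hST, -, hadd, -, -⟩ := hT
  rw [← hST _ hs, ← hST _ ht, ← hST _ (add_pos hs ht),
    ← hadd _ (ofReal_mem_sector hθ hs) _ (ofReal_mem_sector hθ ht)]
  push_cast; rfl

/-- The increments of a bounded analytic semigroup decay. -/
theorem IsBoundedAnalyticSemigroup.exists_norm_sub_le {E : Type*} [NormedAddCommGroup E]
    [NormedSpace ℂ E] {T : ℝ → E →L[ℂ] E} (hT : IsBoundedAnalyticSemigroup T) :
    ∃ C : ℝ, 0 ≤ C ∧ ∀ t τ : ℝ, 0 < t → 0 < τ → ‖T t - T (t + τ)‖ ≤ C * (τ / t) := by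
  obtain ⟨θ, hθ, -, S, hST, hdiff, -, -, M, hM⟩ := hT
  obtain ⟨c, hc, hball⟩ := exists_ball_subset_sector hθ
  have hM0 : 0 ≤ M := (norm_nonneg _).trans (hM 1 (by exact_mod_cast ofReal_mem_sector hθ one_pos))
  refine ⟨(2 * M + 1) / c, by positivity, fun t τ ht hτ => ?_⟩
  have hmem : ∀ s : ℝ, 0 < s → ‖T s‖ ≤ M := fun s hs => by
    rw [← hST s hs]; exact hM _ (ofReal_mem_sector hθ hs)
  by_cases h : τ < c * t
  -- Schwarz's lemma on the disc of radius `c t`. The radius `2M + 1` instead of `2M` gives the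
  -- strict inequality required by an open ball.
  · have hmaps : MapsTo S (Metric.ball (t : ℂ) (c * t)) (Metric.ball (S t) (2 * M + 1)) := by
      intro z hz
      rw [Metric.mem_ball, dist_eq_norm]
      have h1 := hM z (hball t ht hz)
      have h2 := hM t (ofReal_mem_sector hθ ht)
      linarith [norm_sub_le (S z) (S t)]
    have hz : ((t + τ : ℝ) : ℂ) ∈ Metric.ball (t : ℂ) (c * t) := by
      rw [Metric.mem_ball, dist_eq_norm]
      push_cast
      rw [add_sub_cancel_left, Complex.norm_real, Real.norm_of_nonneg hτ.le]; exact h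
    have := Complex.dist_le_div_mul_dist_of_mapsTo_ball (hdiff.mono (hball t ht))
      (hmaps.mono_right Metric.ball_subset_closedBall) hz
    rw [hST _ ht, hST _ (add_pos ht hτ), dist_comm, dist_eq_norm, dist_eq_norm] at this
    refine this.trans (le_of_eq ?_)
    push_cast
    rw [add_sub_cancel_left, Complex.norm_real, Real.norm_of_nonneg hτ.le]
    field_simp
  -- Outside the disc `τ / t ≥ c`, so uniform boundedness is enough.
  · rw [not_lt] at h
    calc ‖T t - T (t + τ)‖ ≤ M + M :=
          (norm_sub_le _ _).trans (add_le_add (hmem _ ht) (hmem _ (add_pos ht hτ)))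
      _ ≤ (2 * M + 1) * 1 := by linarith
      _ ≤ (2 * M + 1) * ((τ / t) / c) := by
          gcongr
          rw [one_le_div hc, le_div_iff₀ ht]; exact h
      _ = _ := by ring

/-! ### Truncation -/

/-- The truncation of `f` to the set where `‖x‖ ≤ j` and `‖f x‖ ≤ j`. -/
def trunc {n : ℕ} (f : Rn n → ℂ) (j : ℕ) : Rn n → ℂ :=
  indicator {x | ‖x‖ ≤ j ∧ ‖f x‖ ≤ j} f

section trunc
variable {n : ℕ} {P : ℝ → Rn n → Rn n → ℂ} {f : Rn n → ℂ}

theorem measurableSet_trunc (hf : Measurable f) (j : ℕ) :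
    MeasurableSet {x : Rn n | ‖x‖ ≤ j ∧ ‖f x‖ ≤ j} :=
  (measurableSet_le measurable_norm measurable_const).inter
    (measurableSet_le hf.norm measurable_const)

theorem measurable_trunc (hf : Measurable f) (j : ℕ) : Measurable (trunc f j) :=
  hf.indicator (measurableSet_trunc hf j)

theorem norm_trunc_le (f : Rn n → ℂ) (j : ℕ) (x : Rn n) : ‖trunc f j x‖ ≤ ‖f x‖ :=
  norm_indicator_le_norm_self _ _

theorem enorm_trunc_le (f : Rn n → ℂ) (j : ℕ) (x : Rn n) : ‖trunc f j x‖ₑ ≤ ‖f x‖ₑ :=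
  enorm_indicator_le_enorm_self _ _

theorem tendsto_trunc (f : Rn n → ℂ) (x : Rn n) :
    Tendsto (fun j => trunc f j x) atTop (𝓝 (f x)) := by
  apply tendsto_const_nhds.congr'
  have h1 := tendsto_natCast_atTop_atTop (R := ℝ) |>.eventually_ge_atTop ‖x‖
  have h2 := tendsto_natCast_atTop_atTop (R := ℝ) |>.eventually_ge_atTop ‖f x‖
  filter_upwards [h1, h2] with j hj1 hj2
  rw [trunc, indicator_of_mem]
  exact ⟨hj1, hj2⟩

theorem memLp_trunc (hf : Measurable f) (j : ℕ) : MemLp (trunc f j) 2 volume := by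
  rw [trunc, memLp_indicator_iff_restrict (measurableSet_trunc hf j)]
  have hsub : {x : Rn n | ‖x‖ ≤ j ∧ ‖f x‖ ≤ j} ⊆ Metric.closedBall 0 j := by
    intro x hx; rw [mem_closedBall_zero_iff]; exact hx.1
  have : IsFiniteMeasure (volume.restrict {x : Rn n | ‖x‖ ≤ j ∧ ‖f x‖ ≤ j}) := by
    constructor
    rw [Measure.restrict_apply_univ]
    exact (measure_mono hsub).trans_lt measure_closedBall_lt_top
  apply MemLp.of_bound hf.aestronglyMeasurable (j : ℝ)
  filter_upwards [ae_restrict_mem (measurableSet_trunc hf j)] with x hx using hx.2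

theorem tendsto_heat (hP : Measurable (fun q : ℝ × Rn n × Rn n => P q.1 q.2.1 q.2.2))
    {u : ℕ → Rn n → ℂ} {v : Rn n → ℂ} {G : Rn n → ℝ} {t : ℝ} {x : Rn n}
    (hu : ∀ j, Measurable (u j)) (hle : ∀ j y, ‖u j y‖ ≤ G y)
    (hint : Integrable (fun y => ‖P t x y‖ * G y))
    (hlim : ∀ y, Tendsto (fun j => u j y) atTop (𝓝 (v y))) :
    Tendsto (fun j => heat P t (u j) x) atTop (𝓝 (heat P t v x)) := by
  apply tendsto_integral_of_dominated_convergence _ _ hint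
  · intro j
    filter_upwards with y
    rw [norm_mul]
    gcongr
    exact hle j y
  · filter_upwards with y using (hlim y).const_mul _
  · exact fun j => ((measurable_kernel_right hP t x).mul (hu j)).aestronglyMeasurable

/-- The semigroup is known only on `L²`, and truncations lie there; this limit carries its
identities and bounds over to `f`. -/
theorem tendsto_heat_trunc (hP : Measurable (fun q : ℝ × Rn n × Rn n => P q.1 q.2.1 q.2.2))
    (hf : Measurable f) {t : ℝ} {x : Rn n} (h : absHeat P t f x < ⊤) :
    Tendsto (fun j => heat P t (trunc f j) x) atTop (𝓝 (heat P t f x)) := by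
  apply tendsto_heat (G := fun y => ‖f y‖) hP (measurable_trunc hf) (norm_trunc_le f) _
    (tendsto_trunc f)
  refine ⟨((measurable_kernel_right hP t x).norm.mul hf.norm).aestronglyMeasurable, ?_⟩
  rw [hasFiniteIntegral_iff_enorm]
  simp only [enorm_mul, enorm_norm]
  exact h

theorem absHeat_mono {u v : Rn n → ℂ} (h : ∀ y, ‖u y‖ₑ ≤ ‖v y‖ₑ) (t : ℝ) (x : Rn n) :
    absHeat P t u x ≤ absHeat P t v x := by
  apply lintegral_mono; intro y; dsimp only; gcongr; exact h y

end trunc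

/-! ### Kernel mass -/

section mass
variable {n : ℕ} {P : ℝ → Rn n → Rn n → ℂ} {C : ℝ≥0}

theorem exists_lintegral_kernel_le (hK : PolyBound P (n + 1) C) :
    ∃ D : ℝ≥0, ∀ t : ℝ, 0 < t →
      (∀ x, ∫⁻ y, ‖P t x y‖ₑ ≤ D) ∧ ∀ y, ∫⁻ x, ‖P t x y‖ₑ ≤ D := by
  obtain ⟨D, hD⟩ := lintegral_decay_le n
  refine ⟨C * D, fun t ht => ?_⟩
  have hst := Real.sqrt_pos.2 ht
  have key : ∀ y : Rn n, C * ENNReal.ofReal (t ^ (-((n : ℝ) / 2))) *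
      (∫⁻ x, decay (n + 1) (√t) x y) ≤ (C * D : ℝ≥0) := fun y => by
    calc _ ≤ C * ENNReal.ofReal (t ^ (-((n : ℝ) / 2))) * (D * ENNReal.ofReal ((√t) ^ n)) := by
          gcongr; exact hD _ hst y
      _ = (C * D) * (ENNReal.ofReal (t ^ (-((n : ℝ) / 2))) * ENNReal.ofReal ((√t) ^ n)) := by ring
      _ = _ := by rw [ofReal_rpow_neg_mul_sqrt_pow n ht]; push_cast; ring
  constructor
  · intro x
    refine le_trans ?_ (key x)
    rw [← lintegral_const_mul _ (measurable_decay_left _ _ _)]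
    apply lintegral_mono; intro y
    dsimp only
    rw [decay_comm]; exact hK t ht x y
  · intro y
    refine le_trans ?_ (key y)
    rw [← lintegral_const_mul _ (measurable_decay_left _ _ _)]
    apply lintegral_mono; intro x
    exact hK t ht x y

theorem exists_lintegral_absHeat_le
    (hP : Measurable (fun q : ℝ × Rn n × Rn n => P q.1 q.2.1 q.2.2))
    (hK : PolyBound P (n + 1) C) :
    ∃ D : ℝ≥0, ∀ f : Rn n → ℂ, Measurable f → ∀ t : ℝ, 0 < t →
      ∫⁻ x, absHeat P t f x ≤ D * ∫⁻ y, ‖f y‖ₑ := by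
  obtain ⟨D, hD⟩ := exists_lintegral_kernel_le hK
  refine ⟨D, fun f hf t ht => ?_⟩
  calc ∫⁻ x, absHeat P t f x = ∫⁻ y, ∫⁻ x, ‖P t x y‖ₑ * ‖f y‖ₑ := by
        apply lintegral_lintegral_swap
        exact ((measurable_kernel hP t).enorm.mul (hf.comp measurable_snd).enorm).aemeasurable
    _ ≤ ∫⁻ y, D * ‖f y‖ₑ := by
        apply lintegral_mono; intro y
        dsimp only
        rw [lintegral_mul_const' _ _ enorm_ne_top]
        gcongr
        exact (hD t ht).2 y
    _ = _ := lintegral_const_mul _ hf.enorm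

end mass

/-! ### Consequences of the `L²` theory -/

section L2
variable {n : ℕ} {P : ℝ → Rn n → Rn n → ℂ} {T : ℝ → L2 n →L[ℂ] L2 n} {C : ℝ≥0}

theorem heat_congr_ae {u v : Rn n → ℂ} (h : u =ᵐ[volume] v) (t : ℝ) : heat P t u = heat P t v := by
  ext x
  apply integral_congr_ae
  filter_upwards [h] with y hy
  rw [hy]

theorem IsKernelOf.toLp_ae_eq (hP : IsKernelOf P T) {u : Rn n → ℂ} (hu : MemLp u 2 volume) {t : ℝ}
    (ht : 0 < t) : (T t (hu.toLp u) : Rn n → ℂ) =ᵐ[volume] heat P t u := by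
  have := hP.2 t ht (hu.toLp u)
  rwa [heat_congr_ae hu.coeFn_toLp t] at this

theorem heat_heat_of_memLp (hT : IsBoundedAnalyticSemigroup T) (hP : IsKernelOf P T)
    {u : Rn n → ℂ} (hu : MemLp u 2 volume) {s t : ℝ} (hs : 0 < s) (ht : 0 < t) :
    heat P s (heat P t u) =ᵐ[volume] heat P (s + t) u := by
  have h1 := hP.toLp_ae_eq hu ht
  have h2 := hP.2 s hs (T t (hu.toLp u))
  rw [heat_congr_ae h1 s] at h2
  refine h2.symm.trans ?_
  have h3 := hP.toLp_ae_eq hu (add_pos hs ht)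
  rw [hT.add hs ht] at h3
  exact h3

theorem enorm_L2_eq (u : L2 n) : ‖u‖ₑ = (∫⁻ x, ‖u x‖ₑ ^ (2 : ℝ)) ^ (1 / 2 : ℝ) := by
  rw [Lp.enorm_def, eLpNorm_eq_lintegral_rpow_enorm_toReal (by norm_num) (by norm_num)]
  simp

theorem enorm_heat_le_L2 (hP : Measurable (fun q : ℝ × Rn n × Rn n => P q.1 q.2.1 q.2.2))
    (t : ℝ) (u : L2 n) (x : Rn n) :
    ‖heat P t u x‖ₑ ≤ (∫⁻ y, ‖P t x y‖ₑ ^ (2 : ℝ)) ^ (1 / 2 : ℝ) * ‖u‖ₑ := by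
  rw [enorm_L2_eq]
  refine (enorm_heat_le t x).trans ?_
  exact ENNReal.lintegral_mul_le_Lp_mul_Lq volume Real.HolderConjugate.two_two
    (measurable_kernel_right hP t x).enorm.aemeasurable
    (Lp.aestronglyMeasurable u).enorm

/-- With `s = t/3`, factor the increment as `T s ∘ (T s - T (s + τ)) ∘ T s`: the right factor maps
`L¹` to `L²`, the middle one has norm `O(τ/s)` on `L²`, and the left one maps `L²` to `L^∞`. Each
smoothing factor costs `s^{-n/4}`. -/
theorem exists_heat_sub_heat_le_of_memLp (hT : IsBoundedAnalyticSemigroup T) (hP : IsKernelOf P T)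
    (hK : PolyBound P (n + 1) C) :
    ∃ D : ℝ≥0, ∀ u : Rn n → ℂ, Measurable u → MemLp u 2 volume → ∀ t τ : ℝ, 0 < t → 0 < τ →
      ∀ᵐ x, ‖heat P t u x - heat P (t + τ) u x‖ₑ ≤
        D * ENNReal.ofReal (τ / t) * ENNReal.ofReal (t ^ (-((n : ℝ) / 2))) * ∫⁻ y, ‖u y‖ₑ := by
  obtain ⟨C₁, hC₁, hsub⟩ := hT.exists_norm_sub_le
  obtain ⟨D₁, hD₁⟩ := exists_lintegral_kernel_le hK
  obtain ⟨D₂, hD₂⟩ := exists_lintegral_absHeat_le hP.1 hK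
  refine ⟨(C * D₁) ^ (1 / 2 : ℝ) * (C * D₂) ^ (1 / 2 : ℝ) * C₁.toNNReal * 3 *
    (3 ^ ((n : ℝ) / 2)), fun u hum hu t τ ht hτ => ?_⟩
  set s := t / 3 with hs
  have hs0 : 0 < s := by positivity
  set I := ∫⁻ y, ‖u y‖ₑ with hI
  set κ := ENNReal.ofReal (s ^ (-((n : ℝ) / 2))) with hκ
  set U := hu.toLp u
  set V := T s U with hV
  set W := (T s - T (s + τ)) V with hW
  have hVae : (V : Rn n → ℂ) =ᵐ[volume] heat P s u := hP.toLp_ae_eq hu hs0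
  -- The `L²` norm squared is at most the supremum times the `L¹` norm.
  have hVnorm : ‖V‖ₑ ≤ (C * D₂ * κ) ^ (1 / 2 : ℝ) * I := by
    rw [enorm_L2_eq, show (C * D₂ * κ) ^ (1 / 2 : ℝ) * I = (C * D₂ * κ * I ^ (2 : ℝ)) ^ (1 / 2 : ℝ) by
      rw [ENNReal.mul_rpow_of_nonneg _ (I ^ (2 : ℝ)) (by norm_num), ← ENNReal.rpow_mul]; norm_num]
    apply ENNReal.rpow_le_rpow _ (by norm_num)
    calc ∫⁻ x, ‖V x‖ₑ ^ (2 : ℝ) = ∫⁻ x, ‖heat P s u x‖ₑ ^ (2 : ℝ) := by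
          apply lintegral_congr_ae
          filter_upwards [hVae] with x hx
          rw [hx]
      _ ≤ ∫⁻ x, (C * κ * I) * absHeat P s u x := by
          apply lintegral_mono; intro x
          dsimp only
          rw [ENNReal.rpow_two, sq]
          gcongr
          · exact (enorm_heat_le s x).trans (absHeat_le_lintegral (hK.mono (Nat.zero_le _)) hs0 x)
          · exact enorm_heat_le s x
      _ = (C * κ * I) * ∫⁻ x, absHeat P s u x :=
          lintegral_const_mul _ (measurable_absHeat hP.1 hum s)
      _ ≤ (C * κ * I) * (D₂ * I) := by gcongr; exact hD₂ u hum s hs0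
      _ = _ := by rw [ENNReal.rpow_two]; ring
  have hWnorm : ‖W‖ₑ ≤ ENNReal.ofReal (C₁ * (τ / s)) * ‖V‖ₑ := by
    refine ((T s - T (s + τ)).le_opENorm V).trans ?_
    gcongr
    rw [← ofReal_norm]
    exact ENNReal.ofReal_le_ofReal (hsub s τ hs0 hτ)
  have hTW : T s W = T t U - T (t + τ) U := by
    have e1 : t = s + (s + s) := by rw [hs]; ring
    have e2 : t + τ = s + ((s + τ) + s) := by rw [hs]; ring
    rw [e2, e1, hT.add hs0 (by positivity), hT.add hs0 hs0, hT.add hs0 (by positivity),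
      hT.add (add_pos hs0 hτ) hs0, hW, hV]
    simp
  -- Cauchy–Schwarz in `y`, with the square integral of the kernel bounded by its supremum times its
  -- mass.
  have hkey : ∀ x, ‖heat P s W x‖ₑ ≤ (C * D₁ * κ) ^ (1 / 2 : ℝ) * ‖W‖ₑ := by
    intro x
    refine (enorm_heat_le_L2 hP.1 s W x).trans ?_
    gcongr
    calc ∫⁻ y, ‖P s x y‖ₑ ^ (2 : ℝ) ≤ ∫⁻ y, (C * κ) * ‖P s x y‖ₑ := by
          apply lintegral_mono; intro y
          dsimp only
          rw [ENNReal.rpow_two, sq]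
          gcongr
          exact (hK s hs0 x y).trans
            (mul_le_of_le_one_right' (decay_le_one _ (Real.sqrt_pos.2 hs0) _ _))
      _ = (C * κ) * ∫⁻ y, ‖P s x y‖ₑ :=
          lintegral_const_mul _ (measurable_kernel_right hP.1 s x).enorm
      _ ≤ (C * κ) * D₁ := by gcongr; exact (hD₁ s hs0).1 x
      _ = _ := by ring
  have hfin : (C * D₁ * κ) ^ (1 / 2 : ℝ) * (ENNReal.ofReal (C₁ * (τ / s)) *
      ((C * D₂ * κ) ^ (1 / 2 : ℝ) * I)) = (((C * D₁) ^ (1 / 2 : ℝ) * (C * D₂) ^ (1 / 2 : ℝ) *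
      C₁.toNNReal * 3 * (3 ^ ((n : ℝ) / 2)) : ℝ≥0) : ℝ≥0∞) * ENNReal.ofReal (τ / t) *
      ENNReal.ofReal (t ^ (-((n : ℝ) / 2))) * I := by
    have hκ2 : κ = (3 ^ ((n : ℝ) / 2) : ℝ≥0) * ENNReal.ofReal (t ^ (-((n : ℝ) / 2))) := by
      rw [hκ, hs, Real.div_rpow ht.le (by norm_num), Real.rpow_neg (by norm_num : (0 : ℝ) ≤ 3),
        div_inv_eq_mul, mul_comm, ENNReal.ofReal_mul (by positivity)]
      congr 1
      rw [← ENNReal.ofReal_coe_nnreal]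
      simp
    have hτ2 : ENNReal.ofReal (C₁ * (τ / s)) = C₁.toNNReal * 3 * ENNReal.ofReal (τ / t) := by
      rw [hs, show C₁ * (τ / (t / 3)) = C₁ * 3 * (τ / t) by field_simp,
        ENNReal.ofReal_mul (by positivity), ENNReal.ofReal_mul hC₁]
      simp [ENNReal.ofReal]
    have hκ3 : κ ^ (1 / 2 : ℝ) * κ ^ (1 / 2 : ℝ) = κ := by
      rw [← ENNReal.rpow_add_of_nonneg _ _ (by norm_num) (by norm_num)]; norm_num
    rw [ENNReal.mul_rpow_of_nonneg _ κ (by norm_num), ENNReal.mul_rpow_of_nonneg _ κ (by norm_num),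
      hτ2]
    push_cast
    rw [ENNReal.coe_rpow_of_nonneg _ (by norm_num), ENNReal.coe_rpow_of_nonneg _ (by norm_num)]
    push_cast
    calc _ = (C * D₁ : ℝ≥0∞) ^ (1 / 2 : ℝ) * (C * D₂ : ℝ≥0∞) ^ (1 / 2 : ℝ) * C₁.toNNReal * 3 *
          (κ ^ (1 / 2 : ℝ) * κ ^ (1 / 2 : ℝ)) * ENNReal.ofReal (τ / t) * I := by ring
      _ = _ := by rw [hκ3, hκ2]; ring
  have h1 := hP.2 s hs0 W
  rw [hTW] at h1
  filter_upwards [h1, Lp.coeFn_sub (T t U) (T (t + τ) U), hP.toLp_ae_eq hu ht,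
    hP.toLp_ae_eq hu (add_pos ht hτ)] with x hx1 hx2 hx3 hx4
  rw [← hx3, ← hx4, ← Pi.sub_apply, ← hx2, hx1, ← hfin]
  refine (hkey x).trans ?_
  gcongr
  exact hWnorm.trans (by gcongr)

/-- Smoothing of increments from `L¹` to `L^∞`. -/
theorem exists_heat_sub_heat_le (hT : IsBoundedAnalyticSemigroup T) (hP : IsKernelOf P T)
    (hK : PolyBound P (n + 1) C) :
    ∃ D : ℝ≥0, ∀ u : Rn n → ℂ, Measurable u → ∫⁻ y, ‖u y‖ₑ < ⊤ → ∀ t τ : ℝ, 0 < t → 0 < τ →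
      ∀ᵐ x, ‖heat P t u x - heat P (t + τ) u x‖ₑ ≤
        D * ENNReal.ofReal (τ / t) * ENNReal.ofReal (t ^ (-((n : ℝ) / 2))) * ∫⁻ y, ‖u y‖ₑ := by
  obtain ⟨D, hD⟩ := exists_heat_sub_heat_le_of_memLp hT hP hK
  refine ⟨D, fun u hum hu t τ ht hτ => ?_⟩
  have h1 : ∀ᵐ x, ∀ j : ℕ, ‖heat P t (trunc u j) x - heat P (t + τ) (trunc u j) x‖ₑ ≤
      D * ENNReal.ofReal (τ / t) * ENNReal.ofReal (t ^ (-((n : ℝ) / 2))) * ∫⁻ y, ‖u y‖ₑ := by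
    rw [ae_all_iff]; intro j
    filter_upwards [hD (trunc u j) (measurable_trunc hum j) (memLp_trunc hum j) t τ ht hτ] with x hx
    refine hx.trans ?_
    gcongr
    exact enorm_trunc_le u j _
  have hfin : ∀ s : ℝ, 0 < s → ∀ x, absHeat P s u x < ⊤ := fun s hs x =>
    (absHeat_le_lintegral (hK.mono (Nat.zero_le _)) hs x).trans_lt
      (ENNReal.mul_lt_top (ENNReal.mul_lt_top ENNReal.coe_lt_top ENNReal.ofReal_lt_top) hu)
  filter_upwards [h1] with x hx
  exact le_of_tendsto ((tendsto_heat_trunc hP.1 hum (hfin t ht x)).sub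
    (tendsto_heat_trunc hP.1 hum (hfin _ (add_pos ht hτ) x))).enorm (Eventually.of_forall hx)

/-- The semigroup law on functions of controlled growth. -/
theorem heat_heat (hT : IsBoundedAnalyticSemigroup T) (hP : IsKernelOf P T)
    (hK : PolyBound P (n + 1) C) {f : Rn n → ℂ} {Φ : ℝ → ℝ≥0∞} (hf : Measurable f)
    (hΦ : BallGrowth (fun y => ‖f y‖ₑ) Φ) {s t : ℝ} (hs : 0 < s) (ht : 0 < t) :
    heat P s (heat P t f) =ᵐ[volume] heat P (s + t) f := by
  have h1 : ∀ᵐ x, ∀ j : ℕ, heat P s (heat P t (trunc f j)) x = heat P (s + t) (trunc f j) x := by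
    rw [ae_all_iff]; intro j
    exact heat_heat_of_memLp hT hP (memLp_trunc hf j) hs ht
  have hfin : ∀ r : ℝ, 0 < r → ∀ x, absHeat P r f x < ⊤ := fun r hr x =>
    (absHeat_le hK hf hΦ hr x).trans_lt (ENNReal.mul_lt_top
      (ENNReal.mul_lt_top ENNReal.coe_lt_top (by norm_num)) (profile_lt_top hΦ hr))
  obtain ⟨D₁, hD₁⟩ := exists_lintegral_kernel_le hK
  filter_upwards [h1] with x hx
  have hB : ((C : ℝ≥0∞) * 2 ^ (n + 2) * profile n Φ t) ≠ ⊤ :=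
    ENNReal.mul_ne_top (ENNReal.mul_ne_top ENNReal.coe_ne_top (by norm_num))
      (profile_lt_top hΦ ht).ne
  -- The two iterated limits agree; the inner heat operator is bounded uniformly in `j` and `y`, so
  -- a constant dominates.
  refine tendsto_nhds_unique (f := fun j => heat P s (heat P t (trunc f j)) x) (l := atTop) ?_ ?_
  · apply tendsto_heat (G := fun _ => ((C : ℝ≥0∞) * 2 ^ (n + 2) * profile n Φ t).toReal) hP.1
      (fun j => measurable_heat hP.1 (measurable_trunc hf j) t)
    · intro j y
      have h2 : ‖heat P t (trunc f j) y‖ₑ ≤ C * 2 ^ (n + 2) * profile n Φ t :=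
        ((enorm_heat_le t y).trans (absHeat_mono (enorm_trunc_le f j) t y)).trans
          (absHeat_le hK hf hΦ ht y)
      rw [← toReal_enorm]
      exact ENNReal.toReal_mono hB h2
    · apply Integrable.mul_const
      refine ⟨(measurable_kernel_right hP.1 s x).norm.aestronglyMeasurable, ?_⟩
      rw [hasFiniteIntegral_iff_enorm]
      simp only [enorm_norm]
      exact ((hD₁ s hs).1 x).trans_lt ENNReal.coe_lt_top
    · exact fun y => tendsto_heat_trunc hP.1 hf (hfin t ht y)
  · simp only [hx]
    exact tendsto_heat_trunc hP.1 hf (hfin _ (add_pos hs ht) x)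

end L2

/-! ### Increments of the heat operator on functions of controlled growth -/

section increments
variable {n : ℕ} {P : ℝ → Rn n → Rn n → ℂ} {T : ℝ → L2 n →L[ℂ] L2 n} {C : ℝ≥0}

/-- Kernels at comparable times obey the same bound. -/
theorem PolyBound.of_le_two_mul {M : ℕ} (hK : PolyBound P M C) {s t : ℝ} (ht : 0 < t) (hs : t ≤ s)
    (hs2 : s ≤ 2 * t) (x y : Rn n) :
    ‖P s x y‖ₑ ≤ C * 2 ^ M * ENNReal.ofReal (t ^ (-((n : ℝ) / 2))) * decay M (√t) x y := by
  have hs0 : 0 < s := ht.trans_le hs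
  have h2 : √s ≤ 2 * √t := by
    rw [show 2 * √t = √(4 * t) by
      rw [Real.sqrt_mul (by norm_num), show (4 : ℝ) = 2 ^ 2 by norm_num,
        Real.sqrt_sq (by norm_num)]]
    exact Real.sqrt_le_sqrt (by linarith)
  calc ‖P s x y‖ₑ ≤ C * ENNReal.ofReal (s ^ (-((n : ℝ) / 2))) * decay M (√s) x y := hK s hs0 x y
    _ ≤ C * ENNReal.ofReal (t ^ (-((n : ℝ) / 2))) * (2 ^ M * decay M (√t) x y) := by
        refine mul_le_mul' (mul_le_mul' le_rfl (ENNReal.ofReal_le_ofReal ?_)) ?_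
        · exact Real.rpow_le_rpow_of_nonpos ht hs (neg_nonpos.2 (by positivity))
        · exact decay_two_mul_le M (Real.sqrt_pos.2 ht) h2 (Real.sqrt_pos.2 hs0) x y
    _ = _ := by ring

theorem decay_le_of_notMem_ball {ρ l : ℝ} (hρ : 0 < ρ) (hl : 0 < l) {x₀ y : Rn n}
    (hy : y ∉ Metric.ball x₀ (l * ρ)) (N : ℕ) : decay N ρ x₀ y ≤ ENNReal.ofReal ((l ^ N)⁻¹) := by
  unfold decay
  apply ENNReal.ofReal_le_ofReal
  apply inv_anti₀ (by positivity)
  apply pow_le_pow_left₀ hl.le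
  rw [Metric.mem_ball, not_lt, dist_comm, dist_eq_norm] at hy
  have : l ≤ ‖x₀ - y‖ / ρ := by rwa [le_div_iff₀ hρ]
  linarith

/-- Decay of the increments of the heat operator on functions of controlled growth. -/
theorem exists_heat_sub_heat_le_profile (hn : n ≠ 0) (hT : IsBoundedAnalyticSemigroup T)
    (hP : IsKernelOf P T) (hK : PolyBound P (2 * n + 1) C) :
    ∃ D : ℝ≥0, ∀ (f : Rn n → ℂ) (Φ : ℝ → ℝ≥0∞), Measurable f →
      BallGrowth (fun y => ‖f y‖ₑ) Φ → ∀ t τ : ℝ, 0 < τ → τ ≤ t →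
      ∀ᵐ x, ‖heat P t f x - heat P (t + τ) f x‖ₑ ≤
        D * ENNReal.ofReal ((τ / t) ^ (1 / 2 : ℝ)) * profile n Φ t := by
  have hK1 : PolyBound P (n + 1) C := hK.mono (by omega)
  obtain ⟨D, hD⟩ := exists_heat_sub_heat_le hT hP hK1
  set E : ℝ≥0 := D + 2 * (C * 2 ^ (2 * n + 1) * 2 ^ (2 * n + 1) * 2 ^ (n + 2)) with hE
  refine ⟨E, fun f Φ hf hΦ t τ hτ hτt => ?_⟩
  have ht : 0 < t := hτ.trans_le hτt
  have hst := Real.sqrt_pos.2 ht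
  have hmF := hf.enorm
  -- Cutting `f` at radius `l √t`, the near part contributes `(τ/t) l^n` and the far part `l^{-n}`.
  -- They balance when `l^n = (t/τ)^{1/2}`.
  set l : ℝ := (t / τ) ^ (1 / (2 * n : ℝ)) with hl
  have hl1 : 1 ≤ l := Real.one_le_rpow ((one_le_div hτ).2 hτt) (by positivity)
  have hl0 : 0 < l := by linarith
  have hn' : (n : ℝ) ≠ 0 := by exact_mod_cast hn
  have hln : l ^ n = (t / τ) ^ (1 / 2 : ℝ) := by
    rw [hl, ← Real.rpow_natCast, ← Real.rpow_mul (by positivity)]; congr 1; field_simp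
  have hln' : (l ^ n)⁻¹ = (τ / t) ^ (1 / 2 : ℝ) := by
    rw [hln, ← Real.inv_rpow (by positivity), inv_div]
  have hlocal : ∀ x₀ : Rn n, ∀ᵐ x, x ∈ Metric.ball x₀ (√t) →
      ‖heat P t f x - heat P (t + τ) f x‖ₑ ≤
        E * ENNReal.ofReal ((τ / t) ^ (1 / 2 : ℝ)) * profile n Φ t := by
    intro x₀
    set B := Metric.ball x₀ (l * √t) with hB
    have hBm : MeasurableSet B := measurableSet_ball
    set u := B.indicator f with hu
    set v := Bᶜ.indicator f with hv
    have hum : Measurable u := hf.indicator hBm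
    have hvm : Measurable v := hf.indicator hBm.compl
    have hI : ∫⁻ y, ‖u y‖ₑ ≤ ENNReal.ofReal (l ^ n) * Φ (√t) := by
      have : ∫⁻ y, ‖u y‖ₑ = ∫⁻ y in B, ‖f y‖ₑ := by
        rw [← lintegral_indicator hBm]
        apply lintegral_congr; intro y
        rw [hu, enorm_indicator_eq_indicator_enorm]
      rw [this]
      exact (hΦ.ball x₀ _ (by positivity)).trans (hΦ.scale _ hst l hl1)
    have hfin : ∀ s, 0 < s → ∀ x, absHeat P s f x < ⊤ := fun s hs x =>
      (absHeat_le hK1 hf hΦ hs x).trans_lt (ENNReal.mul_lt_top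
        (ENNReal.mul_lt_top ENNReal.coe_lt_top (by norm_num)) (profile_lt_top hΦ hs))
    have hsplit : ∀ s, 0 < s → ∀ x, heat P s f x = heat P s u x + heat P s v x := by
      intro s hs x
      have hint : ∀ w : Rn n → ℂ, Measurable w → (∀ y, ‖w y‖ₑ ≤ ‖f y‖ₑ) →
          Integrable (fun y => P s x y * w y) := by
        intro w hw hle
        refine ⟨((measurable_kernel_right hP.1 s x).mul hw).aestronglyMeasurable, ?_⟩
        rw [hasFiniteIntegral_iff_enorm]
        simp only [enorm_mul]
        exact (absHeat_mono hle s x).trans_lt (hfin s hs x)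
      unfold heat
      rw [← integral_add (hint u hum fun y => enorm_indicator_le_enorm_self _ _)
        (hint v hvm fun y => enorm_indicator_le_enorm_self _ _)]
      congr 1; ext y
      rw [← mul_add, hu, hv, indicator_self_add_compl_apply]
    have hfar : ∀ s, t ≤ s → s ≤ 2 * t → ∀ x ∈ Metric.ball x₀ (√t), ‖heat P s v x‖ₑ ≤
        (C * 2 ^ (2 * n + 1) * 2 ^ (2 * n + 1) * 2 ^ (n + 2) : ℝ≥0) *
          ENNReal.ofReal ((τ / t) ^ (1 / 2 : ℝ)) * profile n Φ t := by
      intro s hs hs2 x hx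
      refine (enorm_heat_le s x).trans ?_
      calc absHeat P s v x ≤ ∫⁻ y, (C * 2 ^ (2 * n + 1) * ENNReal.ofReal (t ^ (-((n : ℝ) / 2))) *
            (2 ^ (2 * n + 1) * ENNReal.ofReal ((l ^ n)⁻¹))) *
              (‖f y‖ₑ * decay (n + 1) (√t) x₀ y) := by
            apply lintegral_mono; intro y
            dsimp only
            by_cases hy : y ∈ B
            · rw [hv, indicator_of_notMem (by simpa using hy)]; simp
            · rw [hv, indicator_of_mem hy]
              calc ‖P s x y‖ₑ * ‖f y‖ₑ ≤ (C * 2 ^ (2 * n + 1) *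
                    ENNReal.ofReal (t ^ (-((n : ℝ) / 2))) *
                    (2 ^ (2 * n + 1) * (ENNReal.ofReal ((l ^ n)⁻¹) *
                      decay (n + 1) (√t) x₀ y))) * ‖f y‖ₑ := by
                    gcongr
                    refine (hK.of_le_two_mul ht hs hs2 x y).trans ?_
                    gcongr
                    refine (decay_le_of_mem_ball _ hst hx y).trans ?_
                    gcongr
                    -- The first `n` powers give the gain `l^{-n}` off the ball; the other `n + 1`
                    -- keep the integral convergent.
                    rw [show 2 * n + 1 = n + (n + 1) by ring, decay_add _ _ hst]
                    gcongr
                    exact decay_le_of_notMem_ball hst hl0 hy n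
                _ = _ := by ring
        _ = (C * 2 ^ (2 * n + 1) * ENNReal.ofReal (t ^ (-((n : ℝ) / 2))) *
            (2 ^ (2 * n + 1) * ENNReal.ofReal ((l ^ n)⁻¹))) *
              ∫⁻ y, ‖f y‖ₑ * decay (n + 1) (√t) x₀ y :=
            lintegral_const_mul _ (hmF.mul (measurable_decay_right _ _ _))
        _ ≤ (C * 2 ^ (2 * n + 1) * ENNReal.ofReal (t ^ (-((n : ℝ) / 2))) *
            (2 ^ (2 * n + 1) * ENNReal.ofReal ((l ^ n)⁻¹))) * (2 ^ (n + 2) * Φ (√t)) := by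
            gcongr; exact hΦ.lintegral_decay_le hmF hst x₀
        _ = _ := by rw [hln']; unfold profile; push_cast; ring
    filter_upwards [hD u hum (hI.trans_lt (ENNReal.mul_lt_top ENNReal.ofReal_lt_top
      (hΦ.lt_top _ hst))) t τ ht hτ] with x hx hxB
    rw [hsplit t ht, hsplit _ (add_pos ht hτ)]
    have hnear : ‖heat P t u x - heat P (t + τ) u x‖ₑ ≤
        D * ENNReal.ofReal ((τ / t) ^ (1 / 2 : ℝ)) * profile n Φ t := by
      refine hx.trans ?_
      calc _ ≤ D * ENNReal.ofReal (τ / t) * ENNReal.ofReal (t ^ (-((n : ℝ) / 2))) *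
            (ENNReal.ofReal (l ^ n) * Φ (√t)) := by gcongr
        _ = D * (ENNReal.ofReal (τ / t) * ENNReal.ofReal (l ^ n)) * profile n Φ t := by
            unfold profile; ring
        _ = _ := by
            rw [← ENNReal.ofReal_mul (by positivity)]
            congr 3
            have h0 : 0 < τ / t := by positivity
            rw [hln, show t / τ = (τ / t)⁻¹ by rw [inv_div], Real.inv_rpow h0.le,
              ← Real.rpow_neg h0.le]
            nth_rewrite 1 [← Real.rpow_one (τ / t)]
            rw [← Real.rpow_add h0]; norm_num
    calc _ = ‖(heat P t u x - heat P (t + τ) u x) + heat P t v x - heat P (t + τ) v x‖ₑ := by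
          congr 1; ring
      _ ≤ (‖heat P t u x - heat P (t + τ) u x‖ₑ + ‖heat P t v x‖ₑ) + ‖heat P (t + τ) v x‖ₑ :=
          enorm_sub_le.trans (by gcongr; exact enorm_add_le _ _)
      _ ≤ _ := by
          refine (add_le_add (add_le_add hnear (hfar t le_rfl (by linarith) x hxB))
            (hfar (t + τ) (by linarith) (by linarith) x hxB)).trans (le_of_eq ?_)
          rw [hE]; push_cast; ring
  -- The cut-off, hence the exceptional null set, depends on the centre; countably many balls with
  -- dense centres cover the space.
  have hall : ∀ᵐ x, ∀ i : ℕ, x ∈ Metric.ball (TopologicalSpace.denseSeq (Rn n) i) (√t) →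
      ‖heat P t f x - heat P (t + τ) f x‖ₑ ≤
        E * ENNReal.ofReal ((τ / t) ^ (1 / 2 : ℝ)) * profile n Φ t :=
    ae_all_iff.2 fun i => hlocal _
  filter_upwards [hall] with x hx
  obtain ⟨i, hi⟩ := (TopologicalSpace.denseRange_denseSeq (Rn n)).exists_dist_lt x hst
  exact hx i hi

end increments

/-! ### The fractional integral and its interchange with the semigroup -/

/-- The integral `∫₀^∞ |e^{-tL} f (x)| t^{α/2-1} dt`. -/
def fracAbs {n : ℕ} (P : ℝ → Rn n → Rn n → ℂ) (α : ℝ) (f : Rn n → ℂ) (x : Rn n) : ℝ≥0∞ :=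
  ∫⁻ t in Ioi (0 : ℝ), ‖heat P t f x‖ₑ * ENNReal.ofReal (t ^ (α / 2 - 1))

theorem decay_le_rpow {n : ℕ} {N : ℝ} {M : ℕ} (hNM : N ≤ M) {ρ : ℝ} (hρ : 0 < ρ) (x y : Rn n) :
    decay M ρ x y ≤ ENNReal.ofReal ((1 + ‖x‖ + ρ) ^ M) * ENNReal.ofReal ((1 + ‖y‖) ^ (-N)) := by
  unfold decay
  rw [← ENNReal.ofReal_mul (by positivity)]
  apply ENNReal.ofReal_le_ofReal
  have h1 : 1 + ‖y‖ ≤ (1 + ‖x‖ + ρ) * (1 + ‖x - y‖ / ρ) := by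
    have h2 : ‖y‖ ≤ ‖x‖ + ‖x - y‖ := by
      have := norm_sub_le x (x - y); rwa [sub_sub_cancel] at this
    have h3 : ρ * (‖x - y‖ / ρ) = ‖x - y‖ := by field_simp
    have h4 : 0 ≤ (1 + ‖x‖) * (‖x - y‖ / ρ) := by positivity
    nlinarith
  calc ((1 + ‖x - y‖ / ρ) ^ M)⁻¹
      ≤ (1 + ‖x‖ + ρ) ^ M * ((1 + ‖y‖) ^ M)⁻¹ := by
        rw [inv_eq_one_div, ← div_eq_mul_inv, div_le_div_iff₀ (by positivity) (by positivity),
          one_mul, ← mul_pow]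
        exact pow_le_pow_left₀ (by positivity) h1 M
    _ = (1 + ‖x‖ + ρ) ^ M * (1 + ‖y‖) ^ (-(M : ℝ)) := by
        rw [Real.rpow_neg (by positivity), Real.rpow_natCast]
    _ ≤ _ := by
        gcongr
        linarith [norm_nonneg y]

section frac
variable {n : ℕ} {P : ℝ → Rn n → Rn n → ℂ} {T : ℝ → L2 n →L[ℂ] L2 n} {f : Rn n → ℂ} {α : ℝ}

theorem measurable_fracAbs_integrand
    (hP : Measurable (fun q : ℝ × Rn n × Rn n => P q.1 q.2.1 q.2.2)) (hf : Measurable f) :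
    Measurable (fun q : Rn n × ℝ => heat P q.2 f q.1 * ((q.2 ^ (α / 2 - 1) : ℝ) : ℂ)) := by
  apply ((measurable_heat_prod hP hf).comp measurable_swap).mul
  exact Complex.measurable_ofReal.comp (measurable_snd.pow_const _)

theorem enorm_fracAbs_integrand {t : ℝ} (ht : 0 < t) (z : ℂ) :
    ‖z * ((t ^ (α / 2 - 1) : ℝ) : ℂ)‖ₑ = ‖z‖ₑ * ENNReal.ofReal (t ^ (α / 2 - 1)) := by
  rw [enorm_mul, ← ofReal_norm (((t ^ (α / 2 - 1) : ℝ) : ℂ)), Complex.norm_real,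
    Real.norm_of_nonneg (by positivity)]

theorem lintegral_enorm_eq_fracAbs (x : Rn n) :
    ∫⁻ t in Ioi (0 : ℝ), ‖heat P t f x * ((t ^ (α / 2 - 1) : ℝ) : ℂ)‖ₑ = fracAbs P α f x :=
  setLIntegral_congr_fun measurableSet_Ioi fun _ ht => enorm_fracAbs_integrand ht _

theorem measurable_fracAbs
    (hP : Measurable (fun q : ℝ × Rn n × Rn n => P q.1 q.2.1 q.2.2)) (hf : Measurable f) :
    Measurable (fracAbs P α f) := by
  have h := (measurable_fracAbs_integrand (α := α) hP hf).enorm.lintegral_prod_right'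
    (ν := volume.restrict (Ioi (0 : ℝ)))
  simpa only [lintegral_enorm_eq_fracAbs] using h

theorem measurable_frac
    (hP : Measurable (fun q : ℝ × Rn n × Rn n => P q.1 q.2.1 q.2.2)) (hf : Measurable f) :
    Measurable (frac P α f) := by
  have h := (measurable_fracAbs_integrand (α := α) hP hf).stronglyMeasurable.integral_prod_right'
    (ν := volume.restrict (Ioi (0 : ℝ)))
  exact h.measurable.const_mul _

theorem gamma_inv_nonneg (hα : 0 < α) : 0 ≤ (Real.Gamma (α / 2))⁻¹ :=
  inv_nonneg.2 (Real.Gamma_pos_of_pos (by positivity)).le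

theorem enorm_gamma_inv (hα : 0 < α) :
    ‖(((Real.Gamma (α / 2))⁻¹ : ℝ) : ℂ)‖ₑ = ENNReal.ofReal (Real.Gamma (α / 2))⁻¹ := by
  rw [← ofReal_norm, Complex.norm_real, Real.norm_of_nonneg (gamma_inv_nonneg hα)]

theorem enorm_frac_le (hα : 0 < α) (x : Rn n) :
    ‖frac P α f x‖ₑ ≤ ENNReal.ofReal (Real.Gamma (α / 2))⁻¹ * fracAbs P α f x := by
  unfold frac
  rw [enorm_mul, enorm_gamma_inv hα, ← lintegral_enorm_eq_fracAbs]
  gcongr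
  exact enorm_integral_le_lintegral_enorm _

theorem FracConverges.ae_lt_top (h : FracConverges P α f)
    (hP : Measurable (fun q : ℝ × Rn n × Rn n => P q.1 q.2.1 q.2.2)) (hf : Measurable f) :
    ∀ᵐ x, fracAbs P α f x < ⊤ := by
  obtain ⟨N, hN⟩ := h
  have hm : Measurable (fun x : Rn n => fracAbs P α f x * ENNReal.ofReal ((1 + ‖x‖) ^ (-N))) :=
    (measurable_fracAbs hP hf).mul (by fun_prop)
  filter_upwards [MeasureTheory.ae_lt_top hm hN.ne] with x hx
  rcases ENNReal.mul_lt_top_iff.1 hx with h1 | h1 | h1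
  · exact h1.1
  · rw [h1]; exact ENNReal.zero_lt_top
  · rw [ENNReal.ofReal_eq_zero] at h1
    exact absurd h1 (not_le.2 (Real.rpow_pos_of_pos (by positivity) _))

/-- The exponent `N` in the definition of convergence is arbitrary, but the kernel decays to any
order `M ≥ N` and is therefore dominated by that weight. The resulting finiteness, at every `x`,
justifies Fubini below. -/
theorem lintegral_kernel_mul_fracAbs_le {N : ℝ} {M : ℕ} {C : ℝ≥0} (hNM : N ≤ M)
    (hK : PolyBound P M C) {τ : ℝ} (hτ : 0 < τ) (x : Rn n) :
    ∫⁻ y, ‖P τ x y‖ₑ * fracAbs P α f y ≤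
      C * ENNReal.ofReal (τ ^ (-((n : ℝ) / 2))) * ENNReal.ofReal ((1 + ‖x‖ + √τ) ^ M) *
      ∫⁻ y, fracAbs P α f y * ENNReal.ofReal ((1 + ‖y‖) ^ (-N)) := by
  rw [← lintegral_const_mul' _ _ (by finiteness)]
  apply lintegral_mono; intro y
  calc ‖P τ x y‖ₑ * fracAbs P α f y
      ≤ (C * ENNReal.ofReal (τ ^ (-((n : ℝ) / 2))) * (ENNReal.ofReal ((1 + ‖x‖ + √τ) ^ M) *
          ENNReal.ofReal ((1 + ‖y‖) ^ (-N)))) * fracAbs P α f y := by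
        gcongr
        refine (hK τ hτ x y).trans ?_
        gcongr
        exact decay_le_rpow hNM (Real.sqrt_pos.2 hτ) x y
    _ = _ := by ring

/-- The heat operator commutes with the integral defining `frac`. -/
theorem heat_frac (hconv : FracConverges P α f)
    (hP : Measurable (fun q : ℝ × Rn n × Rn n => P q.1 q.2.1 q.2.2)) (hG : GaussianBound P)
    (hf : Measurable f) {τ : ℝ} (hτ : 0 < τ) (x : Rn n) :
    heat P τ (frac P α f) x = (((Real.Gamma (α / 2))⁻¹ : ℝ) : ℂ) *
      ∫ t in Ioi (0 : ℝ), heat P τ (heat P t f) x * ((t ^ (α / 2 - 1) : ℝ) : ℂ) := by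
  obtain ⟨N, hN⟩ := hconv
  obtain ⟨M, hM⟩ := exists_nat_ge N
  obtain ⟨C, hK⟩ := hG.exists_polyBound M
  have hint : Integrable (Function.uncurry fun (y : Rn n) (t : ℝ) =>
      P τ x y * (heat P t f y * ((t ^ (α / 2 - 1) : ℝ) : ℂ)))
      (volume.prod (volume.restrict (Ioi (0 : ℝ)))) := by
    have hm : Measurable (Function.uncurry fun (y : Rn n) (t : ℝ) =>
      P τ x y * (heat P t f y * ((t ^ (α / 2 - 1) : ℝ) : ℂ))) :=
      ((measurable_kernel_right hP τ x).comp measurable_fst).mul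
        (measurable_fracAbs_integrand hP hf)
    refine ⟨hm.aestronglyMeasurable, ?_⟩
    rw [hasFiniteIntegral_iff_enorm, lintegral_prod _ hm.enorm.aemeasurable]
    have e : ∀ y, ∫⁻ t in Ioi (0 : ℝ), ‖P τ x y * (heat P t f y * ((t ^ (α / 2 - 1) : ℝ) : ℂ))‖ₑ =
        ‖P τ x y‖ₑ * fracAbs P α f y := by
      intro y
      rw [← lintegral_enorm_eq_fracAbs, ← lintegral_const_mul' _ _ enorm_ne_top]
      simp only [enorm_mul]
    simp only [Function.uncurry, e]
    refine (lintegral_kernel_mul_fracAbs_le hM hK hτ x).trans_lt ?_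
    exact ENNReal.mul_lt_top (by finiteness) hN
  calc heat P τ (frac P α f) x
      = ∫ y, (((Real.Gamma (α / 2))⁻¹ : ℝ) : ℂ) *
          ∫ t in Ioi (0 : ℝ), P τ x y * (heat P t f y * ((t ^ (α / 2 - 1) : ℝ) : ℂ)) := by
        unfold heat frac
        congr 1; ext y
        rw [integral_const_mul]; unfold heat; ring
    _ = (((Real.Gamma (α / 2))⁻¹ : ℝ) : ℂ) *
          ∫ t in Ioi (0 : ℝ), ∫ y, P τ x y * (heat P t f y * ((t ^ (α / 2 - 1) : ℝ) : ℂ)) := by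
        rw [integral_const_mul, integral_integral_swap hint]
    _ = _ := by
        congr 1
        congr 1; ext t
        rw [heat, ← integral_mul_const]
        congr 1; ext y; ring

theorem lintegral_lintegral_mul_eq_fracAbs
    (hP : Measurable (fun q : ℝ × Rn n × Rn n => P q.1 q.2.1 q.2.2)) (hf : Measurable f)
    {K : Rn n → ℝ≥0∞} (hK : Measurable K) :
    ∫⁻ t in Ioi (0 : ℝ), ∫⁻ y, K y * ‖heat P t f y * ((t ^ (α / 2 - 1) : ℝ) : ℂ)‖ₑ =
      ∫⁻ y, K y * fracAbs P α f y := by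
  set g : Rn n × ℝ → ℂ := fun q => heat P q.2 f q.1 * ((q.2 ^ (α / 2 - 1) : ℝ) : ℂ) with hg
  have hgm : Measurable g := measurable_fracAbs_integrand hP hf
  have hm : Measurable fun q : ℝ × Rn n => K q.2 * ‖g (q.2, q.1)‖ₑ :=
    (hK.comp measurable_snd).mul (hgm.comp measurable_swap).enorm
  have h1 := lintegral_lintegral_swap (μ := volume.restrict (Ioi (0 : ℝ))) (ν := volume)
    (f := fun t y => K y * ‖g (y, t)‖ₑ) hm.aemeasurable
  refine h1.trans ?_
  apply lintegral_congr; intro y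
  rw [← lintegral_enorm_eq_fracAbs]
  exact lintegral_const_mul _ (hgm.comp (measurable_const.prodMk measurable_id)).enorm

/-- Fubini moves `e^{-τL}` under the time integral, where the semigroup law turns it into a shift of
time by `τ`. -/
theorem enorm_frac_sub_heat_frac_le {Φ : ℝ → ℝ≥0∞} (hα : 0 < α) (hconv : FracConverges P α f)
    (hT : IsBoundedAnalyticSemigroup T) (hP : IsKernelOf P T) (hG : GaussianBound P)
    (hf : Measurable f) (hΦ : BallGrowth (fun y => ‖f y‖ₑ) Φ) {τ : ℝ} (hτ : 0 < τ) :
    ∀ᵐ x, ‖frac P α f x - heat P τ (frac P α f) x‖ₑ ≤ ENNReal.ofReal (Real.Gamma (α / 2))⁻¹ *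
      ∫⁻ t in Ioi (0 : ℝ), ‖heat P t f x - heat P (t + τ) f x‖ₑ *
        ENNReal.ofReal (t ^ (α / 2 - 1)) := by
  obtain ⟨N, hN⟩ := id hconv
  obtain ⟨M, hM⟩ := exists_nat_ge N
  obtain ⟨C, hK⟩ := hG.exists_polyBound M
  obtain ⟨C', hK'⟩ := hG.exists_polyBound (n + 1)
  have hmeas2 : Measurable (fun q : ℝ × Rn n => heat P τ (heat P q.1 f) q.2) := by
    have h : Measurable (fun q : (ℝ × Rn n) × Rn n => P τ q.1.2 q.2 * heat P q.1.1 f q.2) := by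
      apply Measurable.mul
      · exact hP.1.comp (f := fun q : (ℝ × Rn n) × Rn n => (τ, q.1.2, q.2)) (by fun_prop)
      · exact (measurable_heat_prod hP.1 hf).comp
          (f := fun q : (ℝ × Rn n) × Rn n => (q.1.1, q.2)) (by fun_prop)
    exact (h.stronglyMeasurable.integral_prod_right (ν := volume)).measurable
  have hmeas3 : Measurable (fun q : ℝ × Rn n => heat P (q.1 + τ) f q.2) :=
    (measurable_heat_prod hP.1 hf).comp (f := fun q : ℝ × Rn n => (q.1 + τ, q.2)) (by fun_prop)
  have hae : ∀ᵐ t ∂(volume.restrict (Ioi (0 : ℝ))), ∀ᵐ x : Rn n,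
      heat P τ (heat P t f) x = heat P (t + τ) f x := by
    filter_upwards [ae_restrict_mem measurableSet_Ioi] with t ht
    rw [add_comm t τ]
    exact heat_heat hT hP hK' hf hΦ hτ ht
  -- The semigroup law has an exceptional set in `x` for each `t`; joint measurability permits
  -- exchanging the two quantifiers.
  replace hae := (Measure.ae_ae_comm
    (p := fun (t : ℝ) (x : Rn n) => heat P τ (heat P t f) x = heat P (t + τ) f x)
    (measurableSet_eq_fun hmeas2 hmeas3)).1 hae
  filter_upwards [hae, hconv.ae_lt_top hP.1 hf] with x hx hfin
  have hswap : ∫⁻ t in Ioi (0 : ℝ), ‖heat P τ (heat P t f) x * ((t ^ (α / 2 - 1) : ℝ) : ℂ)‖ₑ < ⊤ := by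
    have h1 : ∫⁻ y, ‖P τ x y‖ₑ * fracAbs P α f y < ⊤ :=
      (lintegral_kernel_mul_fracAbs_le hM hK hτ x).trans_lt
        (ENNReal.mul_lt_top (by finiteness) hN)
    refine lt_of_le_of_lt ?_ h1
    calc _ ≤ ∫⁻ t in Ioi (0 : ℝ), ∫⁻ y,
            ‖P τ x y‖ₑ * ‖heat P t f y * ((t ^ (α / 2 - 1) : ℝ) : ℂ)‖ₑ := by
          apply lintegral_mono; intro t
          dsimp only
          rw [enorm_mul]
          simp only [enorm_mul, ← mul_assoc]
          rw [lintegral_mul_const' _ _ enorm_ne_top]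
          gcongr
          refine (enorm_integral_le_lintegral_enorm _).trans (le_of_eq ?_)
          simp only [enorm_mul]
      _ = _ := lintegral_lintegral_mul_eq_fracAbs hP.1 hf
          (measurable_kernel_right hP.1 τ x).enorm
  have hmx : ∀ g : ℝ × Rn n → ℂ, Measurable g → AEStronglyMeasurable
      (fun t => g (t, x) * ((t ^ (α / 2 - 1) : ℝ) : ℂ)) (volume.restrict (Ioi (0 : ℝ))) := by
    intro g hg
    apply Measurable.aestronglyMeasurable
    exact (hg.comp (measurable_id.prodMk measurable_const)).mul
      (Complex.measurable_ofReal.comp (measurable_id.pow_const _))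
  have hi1 : IntegrableOn (fun t => heat P t f x * ((t ^ (α / 2 - 1) : ℝ) : ℂ)) (Ioi (0 : ℝ)) := by
    refine ⟨hmx _ (measurable_heat_prod hP.1 hf), ?_⟩
    rw [hasFiniteIntegral_iff_enorm, lintegral_enorm_eq_fracAbs]; exact hfin
  have hi2 : IntegrableOn (fun t => heat P τ (heat P t f) x * ((t ^ (α / 2 - 1) : ℝ) : ℂ))
      (Ioi (0 : ℝ)) := ⟨hmx _ hmeas2, by rw [hasFiniteIntegral_iff_enorm]; exact hswap⟩
  rw [heat_frac hconv hP.1 hG hf hτ x, frac, ← mul_sub, ← integral_sub hi1 hi2, enorm_mul,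
    enorm_gamma_inv hα]
  gcongr
  refine (enorm_integral_le_lintegral_enorm _).trans (le_of_eq ?_)
  apply lintegral_congr_ae
  filter_upwards [hx, ae_restrict_mem measurableSet_Ioi] with t ht ht0
  rw [ht, ← sub_mul, enorm_fracAbs_integrand ht0]

end frac

/-! ### Mean oscillation of the fractional integral -/

/-- The quantity `t^{(α-n)/2} Φ(√t)`, which controls the mean oscillation of `frac` at scale `√t`. -/
def fracModulus (n : ℕ) (α : ℝ) (Φ : ℝ → ℝ≥0∞) (t : ℝ) : ℝ≥0∞ :=
  profile n Φ t * ENNReal.ofReal (t ^ (α / 2))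

/-- The part `∫₀^τ |P_t| |f| (x) t^{α/2-1} dt` of `frac` coming from times up to `τ`. -/
def shortFrac {n : ℕ} (P : ℝ → Rn n → Rn n → ℂ) (α τ : ℝ) (f : Rn n → ℂ) (x : Rn n) : ℝ≥0∞ :=
  ∫⁻ t in Ioc 0 τ, absHeat P t f x * ENNReal.ofReal (t ^ (α / 2 - 1))

/-- `fracModulus` grows slowly enough to be summed against the decay of the increments. -/
def SlowModulus (n : ℕ) (α : ℝ) (Φ : ℝ → ℝ≥0∞) : Prop :=
  ∀ τ t : ℝ, 0 < τ → τ ≤ t →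
    fracModulus n α Φ t ≤ ENNReal.ofReal ((t / τ) ^ (1 / 4 : ℝ)) * fracModulus n α Φ τ

section osc
variable {n : ℕ} {P : ℝ → Rn n → Rn n → ℂ} {T : ℝ → L2 n →L[ℂ] L2 n} {α : ℝ}

theorem measurable_weight (α : ℝ) :
    Measurable (fun t : ℝ => ENNReal.ofReal (t ^ (α / 2 - 1))) :=
  (measurable_id.pow_const _).ennreal_ofReal

theorem fracModulus_lt_top {F : Rn n → ℝ≥0∞} {Φ : ℝ → ℝ≥0∞} (hΦ : BallGrowth F Φ) {t : ℝ}
    (ht : 0 < t) : fracModulus n α Φ t < ⊤ :=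
  ENNReal.mul_lt_top (profile_lt_top hΦ ht) ENNReal.ofReal_lt_top

theorem lintegral_Ioc_weight (hα : 0 < α) {τ : ℝ} (hτ : 0 < τ) :
    ∫⁻ t in Ioc 0 τ, ENNReal.ofReal (t ^ (α / 2 - 1)) =
      ENNReal.ofReal (τ ^ (α / 2)) * ENNReal.ofReal (α / 2)⁻¹ := by
  rw [lintegral_Ioc_rpow (by linarith) hτ, ← ENNReal.ofReal_mul (by positivity)]
  rw [sub_add_cancel, div_eq_mul_inv]

/-- Cut at `t = τ`. Beyond `τ` the gain `(τ/t)^{1/2}` makes the integral converge. Below `τ`, the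
term at time `t + τ` is bounded by the profile at `τ`, while the term at time `t` is kept as
`shortFrac`: a pointwise bound could produce `∫ dt/t`. -/
theorem exists_lintegral_heat_sub_heat_le (hn : n ≠ 0) (hα : 0 < α)
    (hT : IsBoundedAnalyticSemigroup T) (hP : IsKernelOf P T) (hG : GaussianBound P) :
    ∃ D : ℝ≥0, ∀ (f : Rn n → ℂ) (Φ : ℝ → ℝ≥0∞), Measurable f →
      BallGrowth (fun y => ‖f y‖ₑ) Φ → SlowModulus n α Φ → ∀ τ : ℝ, 0 < τ → ∀ᵐ x,
      ∫⁻ t in Ioi (0 : ℝ), ‖heat P t f x - heat P (t + τ) f x‖ₑ *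
        ENNReal.ofReal (t ^ (α / 2 - 1)) ≤
      shortFrac P α τ f x + D * fracModulus n α Φ τ := by
  obtain ⟨C₁, hK₁⟩ := hG.exists_polyBound (n + 1)
  obtain ⟨C₂, hK₂⟩ := hG.exists_polyBound (2 * n + 1)
  obtain ⟨D, hD⟩ := exists_heat_sub_heat_le_profile hn hT hP hK₂
  refine ⟨C₁ * 2 ^ (n + 2) * Real.toNNReal (α / 2)⁻¹ + D * 4, fun f Φ hf hΦ hω τ hτ => ?_⟩
  have hmd : Measurable (fun q : ℝ × Rn n =>
      ‖heat P q.1 f q.2 - heat P (q.1 + τ) f q.2‖ₑ * ENNReal.ofReal (q.1 ^ (α / 2 - 1))) := by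
    refine Measurable.mul (Measurable.enorm (Measurable.sub (measurable_heat_prod hP.1 hf) ?_))
      ((measurable_weight α).comp measurable_fst)
    exact (measurable_heat_prod hP.1 hf).comp (f := fun q : ℝ × Rn n => (q.1 + τ, q.2)) (by fun_prop)
  have hlarge : ∀ᵐ t ∂(volume.restrict (Ioi τ)), ∀ᵐ x : Rn n,
      ‖heat P t f x - heat P (t + τ) f x‖ₑ * ENNReal.ofReal (t ^ (α / 2 - 1)) ≤
        D * fracModulus n α Φ τ * ENNReal.ofReal (τ ^ (1 / 4 : ℝ)) *
          ENNReal.ofReal (t ^ (-(5 / 4) : ℝ)) := by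
    filter_upwards [ae_restrict_mem measurableSet_Ioi] with t ht
    have ht' : τ < t := ht
    have ht0 : 0 < t := hτ.trans ht'
    filter_upwards [hD f Φ hf hΦ t τ hτ ht'.le] with x hx
    have e1 : ENNReal.ofReal (t ^ (α / 2 - 1)) =
        ENNReal.ofReal (t ^ (α / 2)) * ENNReal.ofReal t⁻¹ := by
      rw [← ENNReal.ofReal_mul (by positivity), Real.rpow_sub_one ht0.ne', div_eq_mul_inv]
    -- The gain `1/2` beats the growth `1/4` allowed by `SlowModulus`. What is left, `τ^{1/4}
    -- t^{-5/4}`, has integral `4` over `t > τ`.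
    have e2 : (τ / t) ^ (1 / 2 : ℝ) * (t / τ) ^ (1 / 4 : ℝ) * t⁻¹ =
        τ ^ (1 / 4 : ℝ) * t ^ (-(5 / 4) : ℝ) := by
      rw [Real.div_rpow hτ.le ht0.le, Real.div_rpow ht0.le hτ.le,
        show (-(5 / 4) : ℝ) = 1 / 4 - 1 / 2 - 1 by norm_num, Real.rpow_sub_one ht0.ne',
        Real.rpow_sub ht0, show (1 / 2 : ℝ) = 1 / 4 + 1 / 4 by norm_num, Real.rpow_add hτ]
      have := Real.rpow_pos_of_pos hτ (1 / 4)
      field_simp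
    calc ‖heat P t f x - heat P (t + τ) f x‖ₑ * ENNReal.ofReal (t ^ (α / 2 - 1))
        ≤ (D * ENNReal.ofReal ((τ / t) ^ (1 / 2 : ℝ)) * profile n Φ t) *
          (ENNReal.ofReal (t ^ (α / 2)) * ENNReal.ofReal t⁻¹) := by rw [e1]; gcongr
      _ = (D * ENNReal.ofReal ((τ / t) ^ (1 / 2 : ℝ)) * ENNReal.ofReal t⁻¹) *
          fracModulus n α Φ t := by unfold fracModulus; ring
      _ ≤ (D * ENNReal.ofReal ((τ / t) ^ (1 / 2 : ℝ)) * ENNReal.ofReal t⁻¹) *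
          (ENNReal.ofReal ((t / τ) ^ (1 / 4 : ℝ)) * fracModulus n α Φ τ) := by
          gcongr; exact hω τ t hτ ht'.le
      _ = D * fracModulus n α Φ τ * (ENNReal.ofReal ((τ / t) ^ (1 / 2 : ℝ)) *
          ENNReal.ofReal ((t / τ) ^ (1 / 4 : ℝ)) * ENNReal.ofReal t⁻¹) := by ring
      _ = _ := by
          rw [← ENNReal.ofReal_mul (by positivity), ← ENNReal.ofReal_mul (by positivity), e2,
            ENNReal.ofReal_mul (by positivity)]
          ring
  replace hlarge := (Measure.ae_ae_comm (μ := volume.restrict (Ioi τ)) (ν := volume)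
    (p := fun (t : ℝ) (x : Rn n) =>
      ‖heat P t f x - heat P (t + τ) f x‖ₑ * ENNReal.ofReal (t ^ (α / 2 - 1)) ≤
        D * fracModulus n α Φ τ * ENNReal.ofReal (τ ^ (1 / 4 : ℝ)) *
          ENNReal.ofReal (t ^ (-(5 / 4) : ℝ)))
    (measurableSet_le hmd (Measurable.const_mul
      ((measurable_fst.pow_const _).ennreal_ofReal) _))).1 hlarge
  filter_upwards [hlarge] with x hx
  rw [← Ioc_union_Ioi_eq_Ioi hτ.le, lintegral_union measurableSet_Ioi
    (Set.disjoint_left.2 fun t h1 h2 => absurd h1.2 (not_le.2 h2))]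
  have hsmall : ∫⁻ t in Ioc 0 τ, ‖heat P t f x - heat P (t + τ) f x‖ₑ *
      ENNReal.ofReal (t ^ (α / 2 - 1)) ≤
      shortFrac P α τ f x +
        C₁ * 2 ^ (n + 2) * Real.toNNReal (α / 2)⁻¹ * fracModulus n α Φ τ := by
    calc _ ≤ ∫⁻ t in Ioc 0 τ, (absHeat P t f x * ENNReal.ofReal (t ^ (α / 2 - 1)) +
          (C₁ * 2 ^ (n + 2) * profile n Φ τ) * ENNReal.ofReal (t ^ (α / 2 - 1))) := by
          apply lintegral_mono_ae
          filter_upwards [ae_restrict_mem measurableSet_Ioc] with t ht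
          rw [← add_mul]
          gcongr
          refine enorm_sub_le.trans (add_le_add (enorm_heat_le t x) ?_)
          refine (enorm_heat_le (t + τ) x).trans ((absHeat_le hK₁ hf hΦ
            (add_pos ht.1 hτ) x).trans ?_)
          gcongr
          exact profile_anti hΦ hτ (by linarith [ht.1])
      _ = _ := by
          rw [lintegral_add_right _ ((measurable_weight α).const_mul _),
            lintegral_const_mul _ (measurable_weight α), lintegral_Ioc_weight hα hτ]
          congr 1
          simp only [fracModulus, ENNReal.ofReal]
          ring
  have hlarge' : ∫⁻ t in Ioi τ, ‖heat P t f x - heat P (t + τ) f x‖ₑ *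
      ENNReal.ofReal (t ^ (α / 2 - 1)) ≤ D * 4 * fracModulus n α Φ τ := by
    refine (lintegral_mono_ae hx).trans ?_
    rw [lintegral_const_mul _ (by fun_prop),
      lintegral_Ioi_rpow (by norm_num) hτ, mul_assoc, ← ENNReal.ofReal_mul (by positivity)]
    have : τ ^ (1 / 4 : ℝ) * (-τ ^ (-(5 / 4) + 1 : ℝ) / (-(5 / 4) + 1)) = 4 := by
      rw [show (-(5 / 4) + 1 : ℝ) = -(1 / 4) by norm_num, Real.rpow_neg hτ.le]
      have := Real.rpow_pos_of_pos hτ (1 / 4)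
      field_simp
    rw [this, show ENNReal.ofReal 4 = 4 by simp]
    exact le_of_eq (by ring)
  refine (add_le_add hsmall hlarge').trans (le_of_eq ?_)
  push_cast
  ring

theorem phi_mul_eq (Φ : ℝ → ℝ≥0∞) {r : ℝ} (hr : 0 < r) :
    Φ r * ENNReal.ofReal ((r ^ 2) ^ (α / 2)) = ENNReal.ofReal (r ^ n) * fracModulus n α Φ (r ^ 2) := by
  have h := ofReal_rpow_neg_mul_sqrt_pow n (t := r ^ 2) (by positivity)
  rw [Real.sqrt_sq hr.le] at h
  unfold fracModulus profile
  rw [Real.sqrt_sq hr.le]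
  calc _ = 1 * Φ r * ENNReal.ofReal ((r ^ 2) ^ (α / 2)) := by rw [one_mul]
    _ = _ := by rw [← h]; ring

/-- Integrating the preceding pointwise bound over the ball, Tonelli reduces `shortFrac` to the mass
of `e^{-tL} f` on the ball for `t ≤ r²`, at most a constant times `Φ(r)`. -/
theorem exists_osc_frac_le (hn : n ≠ 0) (hα : 0 < α)
    (hT : IsBoundedAnalyticSemigroup T) (hP : IsKernelOf P T) (hG : GaussianBound P) :
    ∃ D : ℝ≥0, ∀ (f : Rn n → ℂ) (Φ : ℝ → ℝ≥0∞), Measurable f →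
      BallGrowth (fun y => ‖f y‖ₑ) Φ → SlowModulus n α Φ → FracConverges P α f →
      ∀ (x₀ : Rn n) (r : ℝ), 0 < r → osc P (frac P α f) x₀ r ≤ D * fracModulus n α Φ (r ^ 2) := by
  obtain ⟨C, hK⟩ := hG.exists_polyBound (2 * n + 2)
  obtain ⟨D₁, hD₁⟩ := exists_lintegral_heat_sub_heat_le (α := α) hn hα hT hP hG
  obtain ⟨D₂, hD₂⟩ := exists_setLIntegral_absHeat_le hP.1 hK
  set v := volume (Metric.ball (0 : Rn n) 1) with hv
  have hv0 : v ≠ 0 := (Metric.measure_ball_pos volume _ one_pos).ne'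
  have hvt : v ≠ ⊤ := measure_ball_lt_top.ne
  refine ⟨Real.toNNReal (Real.Gamma (α / 2))⁻¹ *
    (D₂ * Real.toNNReal (α / 2)⁻¹ * (v⁻¹).toNNReal + D₁), fun f Φ hf hΦ hω hconv x₀ r hr => ?_⟩
  set B := Metric.ball x₀ r with hB
  have hvol : volume B = ENNReal.ofReal (r ^ n) * v := by
    rw [hB, Measure.addHaar_ball_of_pos _ _ hr]; simp [hv]
  have hr2 : 0 < r ^ 2 := by positivity
  unfold osc
  rw [hvol]
  apply ENNReal.div_le_of_le_mul
  have hmi : Measurable (fun q : Rn n × ℝ =>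
      absHeat P q.2 f q.1 * ENNReal.ofReal (q.2 ^ (α / 2 - 1))) :=
    ((measurable_absHeat_prod hP.1 hf).comp measurable_swap).mul
      ((measurable_weight α).comp measurable_snd)
  have hinner : ∫⁻ x in B, shortFrac P α (r ^ 2) f x ≤
      D₂ * ENNReal.ofReal (α / 2)⁻¹ * (ENNReal.ofReal (r ^ n) * fracModulus n α Φ (r ^ 2)) := by
    calc _ = ∫⁻ t in Ioc 0 (r ^ 2), ∫⁻ x in B, absHeat P t f x *
          ENNReal.ofReal (t ^ (α / 2 - 1)) := lintegral_lintegral_swap hmi.aemeasurable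
      _ ≤ ∫⁻ t in Ioc 0 (r ^ 2), (D₂ * Φ r) * ENNReal.ofReal (t ^ (α / 2 - 1)) := by
          apply lintegral_mono_ae
          filter_upwards [ae_restrict_mem measurableSet_Ioc] with t ht
          rw [lintegral_mul_const' _ _ ENNReal.ofReal_ne_top]
          gcongr
          exact hD₂ f Φ hf hΦ t r ht.1 (Real.sqrt_le_iff.2 ⟨hr.le, ht.2⟩) x₀
      _ = D₂ * ENNReal.ofReal (α / 2)⁻¹ * (Φ r * ENNReal.ofReal ((r ^ 2) ^ (α / 2))) := by
          rw [lintegral_const_mul _ (measurable_weight α), lintegral_Ioc_weight hα hr2]; ring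
      _ = _ := by rw [phi_mul_eq Φ hr]
  calc ∫⁻ y in B, ‖frac P α f y - heat P (r ^ 2) (frac P α f) y‖ₑ
      ≤ ∫⁻ x in B, ENNReal.ofReal (Real.Gamma (α / 2))⁻¹ *
          (shortFrac P α (r ^ 2) f x + D₁ * fracModulus n α Φ (r ^ 2)) := by
        apply lintegral_mono_ae
        apply ae_restrict_of_ae
        filter_upwards [enorm_frac_sub_heat_frac_le hα hconv hT hP hG hf hΦ hr2,
          hD₁ f Φ hf hΦ hω _ hr2] with x h1 h2
        exact h1.trans (by gcongr)
    _ = ENNReal.ofReal (Real.Gamma (α / 2))⁻¹ * ((∫⁻ x in B, shortFrac P α (r ^ 2) f x) +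
            D₁ * fracModulus n α Φ (r ^ 2) * (ENNReal.ofReal (r ^ n) * v)) := by
        rw [lintegral_const_mul' _ _ ENNReal.ofReal_ne_top, lintegral_add_right _ measurable_const,
          setLIntegral_const, hvol]
    _ ≤ ENNReal.ofReal (Real.Gamma (α / 2))⁻¹ * (D₂ * ENNReal.ofReal (α / 2)⁻¹ *
          (ENNReal.ofReal (r ^ n) * fracModulus n α Φ (r ^ 2)) * (v⁻¹ * v) +
            D₁ * fracModulus n α Φ (r ^ 2) * (ENNReal.ofReal (r ^ n) * v)) := by
        rw [ENNReal.inv_mul_cancel hv0 hvt, mul_one]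
        gcongr
    _ = _ := by
        push_cast
        rw [ENNReal.coe_toNNReal (ENNReal.inv_ne_top.2 hv0)]
        simp only [ENNReal.ofReal]
        ring

end osc

/-! ### Convergence of the fractional integral -/

section welldefined
variable {n : ℕ} {P : ℝ → Rn n → Rn n → ℂ} {T : ℝ → L2 n →L[ℂ] L2 n} {α : ℝ}

theorem decay_one_zero_eq (K : ℕ) (x : Rn n) :
    decay K 1 0 x = ENNReal.ofReal ((1 + ‖x‖) ^ (-(K : ℝ))) := by
  unfold decay
  rw [zero_sub, norm_neg, div_one, Real.rpow_neg (by positivity), Real.rpow_natCast]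

theorem lintegral_decay_zero_lt_top (n : ℕ) : ∫⁻ x : Rn n, decay (n + 1) 1 0 x < ⊤ := by
  obtain ⟨D, hD⟩ := lintegral_decay_le n
  have := hD 1 one_pos (0 : Rn n)
  simp only [decay_comm _ _ _ (0 : Rn n)] at this
  exact this.trans_lt (by finiteness)

/-- The time integral of the kernel bound over `t > 1`. -/
theorem lintegral_Ioi_one_decay_le (hα : 0 < α) (hαn : α < n) (x y : Rn n) :
    ∫⁻ t in Ioi (1 : ℝ), ENNReal.ofReal (t ^ (-((n : ℝ) / 2))) * decay n (√t) x y *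
      ENNReal.ofReal (t ^ (α / 2 - 1)) ≤
    ENNReal.ofReal ((α / 2)⁻¹ + ((n - α) / 2)⁻¹) *
      ENNReal.ofReal ((1 + ‖x - y‖) ^ (-((n : ℝ) - α))) := by
  set D := 1 + ‖x - y‖ with hD
  have hD1 : 1 ≤ D := by rw [hD]; linarith [norm_nonneg (x - y)]
  have hD0 : 0 < D := by linarith
  have hD2 : 0 < D ^ 2 := by positivity
  have ha : 0 < (n : ℝ) - α := by linarith
  -- For `1 < t ≤ D²` the spatial factor is `(√t + ‖x - y‖)^{-n} ≤ D^{-n}`; for `t > D²` the decay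
  -- is dropped and `α < n` gives convergence.
  have hsub : Ioi (1 : ℝ) ⊆ Ioc 1 (D ^ 2) ∪ Ioi (D ^ 2) := by
    intro t ht
    rcases le_or_gt t (D ^ 2) with h | h
    · exact Or.inl ⟨ht, h⟩
    · exact Or.inr h
  have h1 : ∫⁻ t in Ioc 1 (D ^ 2), ENNReal.ofReal (t ^ (-((n : ℝ) / 2))) * decay n (√t) x y *
      ENNReal.ofReal (t ^ (α / 2 - 1)) ≤
      ENNReal.ofReal (α / 2)⁻¹ * ENNReal.ofReal (D ^ (-((n : ℝ) - α))) := by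
    calc _ ≤ ∫⁻ t in Ioc 1 (D ^ 2), ENNReal.ofReal ((D ^ n)⁻¹) *
            ENNReal.ofReal (t ^ (α / 2 - 1)) := by
          apply lintegral_mono_ae
          filter_upwards [ae_restrict_mem measurableSet_Ioc] with t ht
          have ht0 : 0 < t := one_pos.trans ht.1
          have hst : 1 ≤ √t := Real.one_le_sqrt.2 ht.1.le
          gcongr
          unfold decay
          rw [← ENNReal.ofReal_mul (by positivity)]
          apply ENNReal.ofReal_le_ofReal
          rw [Real.rpow_neg ht0.le, ← sqrt_pow_eq ht0, ← mul_inv, ← mul_pow]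
          apply inv_anti₀ (by positivity)
          apply pow_le_pow_left₀ hD0.le
          rw [mul_add, mul_div_cancel₀ _ (by positivity : √t ≠ 0)]
          linarith
      _ ≤ ∫⁻ t in Ioc 0 (D ^ 2), ENNReal.ofReal ((D ^ n)⁻¹) *
            ENNReal.ofReal (t ^ (α / 2 - 1)) :=
          lintegral_mono_set (Ioc_subset_Ioc_left zero_le_one)
      _ = _ := by
          rw [lintegral_const_mul _ (measurable_weight α), lintegral_Ioc_weight hα hD2,
            ← ENNReal.ofReal_mul (by positivity), ← ENNReal.ofReal_mul (by positivity),
            ← ENNReal.ofReal_mul (by positivity)]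
          congr 1
          rw [← Real.rpow_natCast D 2, ← Real.rpow_mul hD0.le, ← Real.rpow_natCast D n,
            ← Real.rpow_neg hD0.le, ← mul_assoc, ← Real.rpow_add hD0, mul_comm]
          congr 2
          push_cast; ring
  have h2 : ∫⁻ t in Ioi (D ^ 2), ENNReal.ofReal (t ^ (-((n : ℝ) / 2))) * decay n (√t) x y *
      ENNReal.ofReal (t ^ (α / 2 - 1)) ≤
      ENNReal.ofReal ((n - α) / 2)⁻¹ * ENNReal.ofReal (D ^ (-((n : ℝ) - α))) := by
    calc _ ≤ ∫⁻ t in Ioi (D ^ 2), ENNReal.ofReal (t ^ (-(((n : ℝ) - α) / 2) - 1)) := by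
          apply lintegral_mono_ae
          filter_upwards [ae_restrict_mem measurableSet_Ioi] with t ht
          have ht0 : 0 < t := hD2.trans ht
          calc _ ≤ ENNReal.ofReal (t ^ (-((n : ℝ) / 2))) * 1 *
                ENNReal.ofReal (t ^ (α / 2 - 1)) := by
                gcongr; exact decay_le_one _ (Real.sqrt_pos.2 ht0) _ _
            _ = _ := by
                rw [mul_one, ← ENNReal.ofReal_mul (by positivity), ← Real.rpow_add ht0]
                congr 2; ring
      _ = _ := by
          rw [lintegral_Ioi_rpow (by linarith) hD2, ← ENNReal.ofReal_mul (by positivity)]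
          congr 1
          rw [sub_add_cancel, ← Real.rpow_natCast D 2, ← Real.rpow_mul hD0.le, neg_div_neg_eq,
            div_eq_inv_mul]
          congr 2
          push_cast; ring
  calc _ ≤ ∫⁻ t in Ioc 1 (D ^ 2) ∪ Ioi (D ^ 2), ENNReal.ofReal (t ^ (-((n : ℝ) / 2))) *
        decay n (√t) x y * ENNReal.ofReal (t ^ (α / 2 - 1)) := lintegral_mono_set hsub
    _ ≤ _ := lintegral_union_le _ _ _
    _ ≤ _ := add_le_add h1 h2
    _ = _ := by rw [← add_mul, ENNReal.ofReal_add (by positivity) (by positivity)]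

/-- The weighted `L¹` norm of `e^{-tL} f` is bounded for `t ≤ 1`, and `t^{β-1}` is integrable at
`0`. The exponent is free because both `α/2` and `α/4` are needed. -/
theorem lintegral_shortFrac_mul_le {C : ℝ≥0}
    (hP : Measurable (fun q : ℝ × Rn n × Rn n => P q.1 q.2.1 q.2.2))
    (hK : PolyBound P (2 * n + 2) C) {f : Rn n → ℂ} {Φ : ℝ → ℝ≥0∞} (hf : Measurable f)
    (hΦ : BallGrowth (fun y => ‖f y‖ₑ) Φ) {β : ℝ} (hβ : 0 < β) :
    ∫⁻ x, (∫⁻ t in Ioc (0 : ℝ) 1, absHeat P t f x * ENNReal.ofReal (t ^ (β - 1))) *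
      decay (n + 1) 1 0 x < ⊤ := by
  obtain ⟨D, hD⟩ := exists_lintegral_absHeat_mul_decay_le hP hK
  have hm1 : Measurable (fun q : Rn n × ℝ => absHeat P q.2 f q.1) :=
    (measurable_absHeat_prod hP hf).comp measurable_swap
  have hm2 : Measurable (fun t : ℝ => ENNReal.ofReal (t ^ (β - 1))) :=
    (measurable_id.pow_const _).ennreal_ofReal
  have hm : Measurable (fun q : Rn n × ℝ => absHeat P q.2 f q.1 * ENNReal.ofReal (q.2 ^ (β - 1)) *
      decay (n + 1) 1 0 q.1) :=
    (hm1.mul (hm2.comp measurable_snd)).mul ((measurable_decay_right _ _ _).comp measurable_fst)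
  have hfin : D * (2 ^ (n + 2) * Φ 1) < ⊤ :=
    ENNReal.mul_lt_top ENNReal.coe_lt_top (ENNReal.mul_lt_top (by finiteness) (hΦ.lt_top 1 one_pos))
  calc _ = ∫⁻ x, ∫⁻ t in Ioc (0 : ℝ) 1, absHeat P t f x * ENNReal.ofReal (t ^ (β - 1)) *
          decay (n + 1) 1 0 x := by
        apply lintegral_congr; intro x
        rw [lintegral_mul_const' _ _ (decay_ne_top _ _ _ _)]
    _ = ∫⁻ t in Ioc (0 : ℝ) 1, ∫⁻ x, absHeat P t f x * ENNReal.ofReal (t ^ (β - 1)) *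
          decay (n + 1) 1 0 x := lintegral_lintegral_swap hm.aemeasurable
    _ ≤ ∫⁻ t in Ioc (0 : ℝ) 1, (D * (2 ^ (n + 2) * Φ 1)) * ENNReal.ofReal (t ^ (β - 1)) := by
        apply lintegral_mono_ae
        filter_upwards [ae_restrict_mem measurableSet_Ioc] with t ht
        calc _ = ∫⁻ x, (absHeat P t f x * decay (n + 1) 1 0 x) * ENNReal.ofReal (t ^ (β - 1)) := by
              apply lintegral_congr; intro x; ring
          _ = (∫⁻ x, absHeat P t f x * decay (n + 1) 1 0 x) * ENNReal.ofReal (t ^ (β - 1)) :=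
              lintegral_mul_const' _ _ ENNReal.ofReal_ne_top
          _ ≤ _ := by
              gcongr
              refine (hD f hf t 1 ht.1 (Real.sqrt_le_one.2 ht.2) 0).trans ?_
              gcongr
              exact hΦ.lintegral_decay_le hf.enorm one_pos 0
    _ = (D * (2 ^ (n + 2) * Φ 1)) * ENNReal.ofReal (1 ^ β / β) := by
        rw [lintegral_const_mul _ hm2, lintegral_Ioc_rpow (by linarith) one_pos, sub_add_cancel]
    _ < ⊤ := ENNReal.mul_lt_top hfin ENNReal.ofReal_lt_top

/-- Replaces the varying point `x` by the single point where the Riesz potential is finite, at a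
cost polynomial in `x`. -/
theorem rpow_neg_le_of_norm_sub {a : ℝ} (ha : 0 < a) (han : a ≤ n) (x₀ x y : Rn n) (hy : y ≠ x₀) :
    (1 + ‖x - y‖) ^ (-a) ≤ ((1 + ‖x₀‖) * (1 + ‖x‖)) ^ n * (‖x₀ - y‖ ^ a)⁻¹ := by
  have hd : 0 < ‖x₀ - y‖ := norm_pos_iff.2 (sub_ne_zero.2 hy.symm)
  rw [Real.rpow_neg (by positivity), ← div_eq_mul_inv, inv_eq_one_div,
    div_le_div_iff₀ (by positivity) (by positivity), one_mul]
  have h0 : 1 ≤ (1 + ‖x₀‖) * (1 + ‖x‖) := by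
    nlinarith [norm_nonneg x₀, norm_nonneg x, mul_nonneg (norm_nonneg x₀) (norm_nonneg x)]
  have h1 : ‖x₀ - y‖ ≤ (1 + ‖x₀‖) * (1 + ‖x‖) * (1 + ‖x - y‖) := by
    have h2 : ‖x₀ - y‖ ≤ ‖x₀‖ + ‖x‖ + ‖x - y‖ :=
      (norm_sub_le_norm_sub_add_norm_sub x₀ x y).trans (by gcongr; exact norm_sub_le _ _)
    have h3 : ‖x₀‖ + ‖x‖ ≤ (1 + ‖x₀‖) * (1 + ‖x‖) := by
      nlinarith [mul_nonneg (norm_nonneg x₀) (norm_nonneg x)]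
    nlinarith [norm_nonneg (x - y)]
  calc ‖x₀ - y‖ ^ a ≤ ((1 + ‖x₀‖) * (1 + ‖x‖) * (1 + ‖x - y‖)) ^ a := by gcongr
    _ = ((1 + ‖x₀‖) * (1 + ‖x‖)) ^ a * (1 + ‖x - y‖) ^ a :=
        Real.mul_rpow (by positivity) (by positivity)
    _ ≤ ((1 + ‖x₀‖) * (1 + ‖x‖)) ^ (n : ℝ) * (1 + ‖x - y‖) ^ a := by gcongr
    _ = _ := by rw [Real.rpow_natCast]

/-- Long times are controlled by the Riesz potential at any single point. -/
theorem lintegral_Ioi_one_absHeat_le {C : ℝ≥0} (hα : 0 < α) (hαn : α < n)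
    (hP : Measurable (fun q : ℝ × Rn n × Rn n => P q.1 q.2.1 q.2.2))
    (hK : PolyBound P n C) {f : Rn n → ℂ} (hf : Measurable f) (x₀ x : Rn n) :
    ∫⁻ t in Ioi (1 : ℝ), absHeat P t f x * ENNReal.ofReal (t ^ (α / 2 - 1)) ≤
      C * ENNReal.ofReal ((α / 2)⁻¹ + ((n - α) / 2)⁻¹) *
        ENNReal.ofReal (((1 + ‖x₀‖) * (1 + ‖x‖)) ^ n) * rieszAbs α f x₀ := by
  have hm : Measurable (fun q : ℝ × Rn n => ‖P q.1 x q.2‖ₑ * ‖f q.2‖ₑ *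
      ENNReal.ofReal (q.1 ^ (α / 2 - 1))) := by
    refine (Measurable.mul ?_ (hf.comp measurable_snd).enorm).mul
      ((measurable_weight α).comp measurable_fst)
    exact (hP.comp (f := fun q : ℝ × Rn n => (q.1, x, q.2)) (by fun_prop)).enorm
  have h1 : ∀ y, ∫⁻ t in Ioi (1 : ℝ), ‖P t x y‖ₑ * ‖f y‖ₑ * ENNReal.ofReal (t ^ (α / 2 - 1)) ≤
      ‖f y‖ₑ * (C * (ENNReal.ofReal ((α / 2)⁻¹ + ((n - α) / 2)⁻¹) *
        ENNReal.ofReal ((1 + ‖x - y‖) ^ (-((n : ℝ) - α))))) := by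
    intro y
    calc _ ≤ ∫⁻ t in Ioi (1 : ℝ), (‖f y‖ₑ * C) * (ENNReal.ofReal (t ^ (-((n : ℝ) / 2))) *
            decay n (√t) x y * ENNReal.ofReal (t ^ (α / 2 - 1))) := by
          apply lintegral_mono_ae
          filter_upwards [ae_restrict_mem measurableSet_Ioi] with t ht
          calc _ ≤ (C * ENNReal.ofReal (t ^ (-((n : ℝ) / 2))) * decay n (√t) x y) * ‖f y‖ₑ *
                ENNReal.ofReal (t ^ (α / 2 - 1)) := by
                gcongr; exact hK t (one_pos.trans ht) x y
            _ = _ := by ring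
      _ = (‖f y‖ₑ * C) * ∫⁻ t in Ioi (1 : ℝ), (ENNReal.ofReal (t ^ (-((n : ℝ) / 2))) *
            decay n (√t) x y * ENNReal.ofReal (t ^ (α / 2 - 1))) :=
          lintegral_const_mul' _ _ (by finiteness)
      _ ≤ _ := by rw [mul_assoc]; gcongr; exact lintegral_Ioi_one_decay_le hα hαn x y
  calc _ = ∫⁻ t in Ioi (1 : ℝ), ∫⁻ y, ‖P t x y‖ₑ * ‖f y‖ₑ * ENNReal.ofReal (t ^ (α / 2 - 1)) := by
        apply lintegral_congr; intro t
        rw [lintegral_mul_const' _ _ ENNReal.ofReal_ne_top]; rfl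
    _ = ∫⁻ y, ∫⁻ t in Ioi (1 : ℝ), ‖P t x y‖ₑ * ‖f y‖ₑ * ENNReal.ofReal (t ^ (α / 2 - 1)) :=
        lintegral_lintegral_swap hm.aemeasurable
    _ ≤ ∫⁻ y, (C * ENNReal.ofReal ((α / 2)⁻¹ + ((n - α) / 2)⁻¹) *
        ENNReal.ofReal (((1 + ‖x₀‖) * (1 + ‖x‖)) ^ n)) *
          (‖f y‖ₑ / ENNReal.ofReal (‖x₀ - y‖ ^ ((n : ℝ) - α))) := by
        apply lintegral_mono; intro y
        refine (h1 y).trans ?_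
        -- At `y = x₀` the Riesz kernel divides by zero, so the right side is `⊤` unless `f y` or
        -- `C` vanishes.
        by_cases hy : y = x₀
        · rcases eq_or_ne (‖f y‖ₑ) 0 with h0 | h0
          · simp [h0]
          · have hz : ENNReal.ofReal (‖x₀ - y‖ ^ ((n : ℝ) - α)) = 0 := by
              rw [hy, sub_self, norm_zero, Real.zero_rpow (by linarith), ENNReal.ofReal_zero]
            rcases eq_or_ne C 0 with hC | hC
            · simp [hC]
            · have ha : 0 < (n : ℝ) - α := by linarith
              dsimp only
              rw [hz, ENNReal.div_zero h0, ENNReal.mul_top]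
              · exact le_top
              · refine mul_ne_zero (mul_ne_zero (by exact_mod_cast hC) ?_) ?_ <;>
                  rw [Ne, ENNReal.ofReal_eq_zero, not_le] <;> positivity
        · have hd : 0 < ‖x₀ - y‖ := norm_pos_iff.2 (sub_ne_zero.2 (Ne.symm hy))
          calc _ ≤ ‖f y‖ₑ * (C * (ENNReal.ofReal ((α / 2)⁻¹ + ((n - α) / 2)⁻¹) *
                (ENNReal.ofReal (((1 + ‖x₀‖) * (1 + ‖x‖)) ^ n) *
                  (ENNReal.ofReal (‖x₀ - y‖ ^ ((n : ℝ) - α)))⁻¹))) := by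
                gcongr
                rw [← ENNReal.ofReal_inv_of_pos (by positivity), ← ENNReal.ofReal_mul (by positivity)]
                apply ENNReal.ofReal_le_ofReal
                exact rpow_neg_le_of_norm_sub (by linarith) (by linarith) x₀ x y hy
            _ = _ := by dsimp only; rw [ENNReal.div_eq_inv_mul]; ring
    _ = _ := lintegral_const_mul' _ _ (by finiteness)

theorem fracAbs_le (f : Rn n → ℂ) (x : Rn n) : fracAbs P α f x ≤ shortFrac P α 1 f x +
    ∫⁻ t in Ioi (1 : ℝ), absHeat P t f x * ENNReal.ofReal (t ^ (α / 2 - 1)) := by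
  unfold fracAbs shortFrac
  rw [← Ioc_union_Ioi_eq_Ioi zero_le_one]
  refine (lintegral_union_le _ _ _).trans ?_
  refine add_le_add (lintegral_mono fun t => ?_) (lintegral_mono fun t => ?_) <;>
    exact mul_le_mul' (enorm_heat_le _ _) le_rfl

theorem fracConverges_of_rieszAbs_lt_top (hα : 0 < α) (hαn : α < n)
    (hP : Measurable (fun q : ℝ × Rn n × Rn n => P q.1 q.2.1 q.2.2)) (hG : GaussianBound P)
    {f : Rn n → ℂ} {Φ : ℝ → ℝ≥0∞} (hf : Measurable f) (hΦ : BallGrowth (fun y => ‖f y‖ₑ) Φ)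
    {x₀ : Rn n} (hx₀ : rieszAbs α f x₀ < ⊤) : FracConverges P α f := by
  obtain ⟨C₁, hK₁⟩ := hG.exists_polyBound (2 * n + 2)
  obtain ⟨C₂, hK₂⟩ := hG.exists_polyBound n
  -- The first `n` powers absorb the growth in `x` of the long-time part; `n + 1` more make the
  -- weight integrable.
  refine ⟨((n + (n + 1) : ℕ) : ℝ), ?_⟩
  change ∫⁻ x, fracAbs P α f x * _ < ⊤
  simp only [← decay_one_zero_eq]
  set A : ℝ≥0∞ := C₂ * ENNReal.ofReal ((α / 2)⁻¹ + ((n - α) / 2)⁻¹) *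
    ENNReal.ofReal ((1 + ‖x₀‖) ^ n) * rieszAbs α f x₀ with hA
  have hAt : A < ⊤ := ENNReal.mul_lt_top (by finiteness) hx₀
  have hms : Measurable (fun x => shortFrac P α 1 f x * decay (n + 1) 1 0 x) := by
    refine Measurable.mul ?_ (measurable_decay_right _ _ _)
    have hmi : Measurable (fun q : Rn n × ℝ =>
        absHeat P q.2 f q.1 * ENNReal.ofReal (q.2 ^ (α / 2 - 1))) :=
      ((measurable_absHeat_prod hP hf).comp measurable_swap).mul
        ((measurable_weight α).comp measurable_snd)
    exact hmi.lintegral_prod_right'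
  calc ∫⁻ x, fracAbs P α f x * decay (n + (n + 1)) 1 0 x
      ≤ ∫⁻ x, (shortFrac P α 1 f x * decay (n + 1) 1 0 x + A * decay (n + 1) 1 0 x) := by
        apply lintegral_mono; intro x
        have hlong : ENNReal.ofReal (((1 + ‖x₀‖) * (1 + ‖x‖)) ^ n) * decay n 1 0 x =
            ENNReal.ofReal ((1 + ‖x₀‖) ^ n) := by
          unfold decay
          rw [← ENNReal.ofReal_mul (by positivity), zero_sub, norm_neg, div_one, mul_pow]
          congr 1; field_simp
        calc _ ≤ (shortFrac P α 1 f x + C₂ * ENNReal.ofReal ((α / 2)⁻¹ + ((n - α) / 2)⁻¹) *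
              ENNReal.ofReal (((1 + ‖x₀‖) * (1 + ‖x‖)) ^ n) * rieszAbs α f x₀) *
              decay (n + (n + 1)) 1 0 x := by
              refine mul_le_mul' ((fracAbs_le f x).trans ?_) le_rfl
              gcongr
              exact lintegral_Ioi_one_absHeat_le hα hαn hP hK₂ hf x₀ x
          _ = shortFrac P α 1 f x * decay (n + (n + 1)) 1 0 x +
              C₂ * ENNReal.ofReal ((α / 2)⁻¹ + ((n - α) / 2)⁻¹) *
              (ENNReal.ofReal (((1 + ‖x₀‖) * (1 + ‖x‖)) ^ n) * decay n 1 0 x) *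
                rieszAbs α f x₀ * decay (n + 1) 1 0 x := by
              rw [add_mul, decay_add n (n + 1) one_pos]; ring
          _ ≤ _ := by
              rw [hlong]
              exact add_le_add (mul_le_mul' le_rfl (decay_anti (by omega) one_pos _ _)) le_rfl
    _ = (∫⁻ x, shortFrac P α 1 f x * decay (n + 1) 1 0 x) + A * ∫⁻ x : Rn n, decay (n + 1) 1 0 x := by
        rw [lintegral_add_left hms, lintegral_const_mul _ (measurable_decay_right _ _ _)]
    _ < ⊤ := by
        refine ENNReal.add_lt_top.2 ⟨?_, ENNReal.mul_lt_top hAt (lintegral_decay_zero_lt_top n)⟩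
        exact lintegral_shortFrac_mul_le hP hK₁ hf hΦ (by positivity : 0 < α / 2)

end welldefined

/-! ### Weighted square integrability of the fractional integral -/

theorem ennreal_add_sq_le (a b : ℝ≥0∞) : (a + b) ^ 2 ≤ 4 * (a ^ 2 + b ^ 2) := by
  rcases le_total a b with h | h
  · calc (a + b) ^ 2 ≤ (b + b) ^ 2 := by gcongr
      _ = 4 * b ^ 2 := by ring
      _ ≤ _ := by gcongr; exact le_add_self
  · calc (a + b) ^ 2 ≤ (a + a) ^ 2 := by gcongr
      _ = 4 * a ^ 2 := by ring
      _ ≤ _ := by gcongr; exact le_self_add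

theorem ennreal_le_one_add_sq (a : ℝ≥0∞) : a ≤ 1 + a ^ 2 := by
  rcases le_total a 1 with h | h
  · exact h.trans le_self_add
  · exact (le_self_pow₀ h two_ne_zero).trans le_add_self

section memType
variable {n : ℕ} {P : ℝ → Rn n → Rn n → ℂ} {T : ℝ → L2 n →L[ℂ] L2 n} {α : ℝ}

theorem memType_of_lintegral_sq_lt_top {g : Rn n → ℂ} (hg : Measurable g) {m : ℕ}
    (h : ∫⁻ x, ‖g x‖ₑ ^ 2 * decay (n + (m + 1)) 1 0 x < ⊤) : MemType g := by
  refine ⟨?_, (m + 1 : ℕ), by positivity, ?_⟩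
  · rw [locallyIntegrable_iff]
    intro k hk
    obtain ⟨R, hR0, hR⟩ : ∃ R : ℝ, 0 ≤ R ∧ k ⊆ Metric.closedBall 0 R := by
      obtain ⟨R, hR⟩ := hk.isBounded.subset_closedBall (0 : Rn n)
      exact ⟨max R 0, le_max_right _ _, hR.trans (Metric.closedBall_subset_closedBall (le_max_left _ _))⟩
    refine IntegrableOn.mono_set ⟨hg.aestronglyMeasurable, ?_⟩ hR
    rw [hasFiniteIntegral_iff_enorm]
    calc ∫⁻ x in Metric.closedBall 0 R, ‖g x‖ₑ
        ≤ ∫⁻ x in Metric.closedBall 0 R, (1 + ENNReal.ofReal ((1 + R) ^ (n + (m + 1))) *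
            (‖g x‖ₑ ^ 2 * decay (n + (m + 1)) 1 0 x)) := by
          apply lintegral_mono_ae
          filter_upwards [ae_restrict_mem Metric.isClosed_closedBall.measurableSet] with x hx
          refine (ennreal_le_one_add_sq _).trans ?_
          gcongr
          have hx' : ‖x‖ ≤ R := by simpa using hx
          have h1 : 1 ≤ ENNReal.ofReal ((1 + R) ^ (n + (m + 1))) * decay (n + (m + 1)) 1 0 x := by
            unfold decay
            rw [← ENNReal.ofReal_mul (by positivity), zero_sub, norm_neg, div_one,
              ENNReal.one_le_ofReal, ← div_eq_mul_inv, one_le_div (by positivity)]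
            gcongr
          calc ‖g x‖ₑ ^ 2 = ‖g x‖ₑ ^ 2 * 1 := (mul_one _).symm
            _ ≤ ‖g x‖ₑ ^ 2 * (ENNReal.ofReal ((1 + R) ^ (n + (m + 1))) *
                decay (n + (m + 1)) 1 0 x) := by gcongr
            _ = _ := by ring
      _ = volume (Metric.closedBall (0 : Rn n) R) + ENNReal.ofReal ((1 + R) ^ (n + (m + 1))) *
            ∫⁻ x in Metric.closedBall 0 R, (‖g x‖ₑ ^ 2 * decay (n + (m + 1)) 1 0 x) := by
          rw [lintegral_add_left measurable_const, setLIntegral_const, one_mul,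
            lintegral_const_mul' _ _ ENNReal.ofReal_ne_top]
      _ < ⊤ := ENNReal.add_lt_top.2 ⟨measure_closedBall_lt_top,
          ENNReal.mul_lt_top ENNReal.ofReal_lt_top ((setLIntegral_le_lintegral _ _).trans_lt h)⟩
  · refine lt_of_le_of_lt (le_of_eq ?_) h
    apply lintegral_congr; intro x
    have e : (1 + ‖x‖) ^ ((n : ℝ) + ((m + 1 : ℕ) : ℝ)) = (1 + ‖x‖) ^ (n + (m + 1)) := by
      rw [← Nat.cast_add, Real.rpow_natCast]
    rw [e, div_eq_mul_inv, ← ENNReal.ofReal_inv_of_pos (by positivity)]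
    unfold decay
    rw [zero_sub, norm_neg, div_one]

/-- Cauchy–Schwarz in time with `t^{α/2-1} = t^{α/8-1/2} · t^{3α/8-1/2}`. The first factor squared
integrates to `4/α`. In the second, one copy of `absHeat` times `t^{α/2}` is bounded pointwise
through `B`, so only a first power of `absHeat` remains; thus no integrability of `f` beyond `L¹` on
balls is used. -/
theorem shortFrac_sq_le {C : ℝ≥0} (hα : 0 < α)
    (hP : Measurable (fun q : ℝ × Rn n × Rn n => P q.1 q.2.1 q.2.2))
    (hK : PolyBound P (n + 1) C) {f : Rn n → ℂ} {Φ : ℝ → ℝ≥0∞} (hf : Measurable f)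
    (hΦ : BallGrowth (fun y => ‖f y‖ₑ) Φ) {B : ℝ≥0∞} (hBt : B ≠ ⊤)
    (hB : ∀ t, 0 < t → t ≤ 1 → fracModulus n α Φ t ≤ B) (x : Rn n) :
    shortFrac P α 1 f x ^ 2 ≤ ENNReal.ofReal (α / 4)⁻¹ * (C * 2 ^ (n + 2) * B) *
      ∫⁻ t in Ioc (0 : ℝ) 1, absHeat P t f x * ENNReal.ofReal (t ^ (α / 4 - 1)) := by
  have hma : Measurable (fun t : ℝ => absHeat P t f x) :=
    (measurable_absHeat_prod hP hf).comp (measurable_id.prodMk measurable_const)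
  have hmp : ∀ b : ℝ, Measurable (fun t : ℝ => ENNReal.ofReal (t ^ b)) := fun b =>
    (measurable_id.pow_const _).ennreal_ofReal
  have hCS := ENNReal.lintegral_mul_le_Lp_mul_Lq (volume.restrict (Ioc (0 : ℝ) 1))
    Real.HolderConjugate.two_two (hmp (α / 8 - 1 / 2)).aemeasurable
    (g := fun t : ℝ => absHeat P t f x * ENNReal.ofReal (t ^ (3 * α / 8 - 1 / 2)))
    (hma.mul (hmp (3 * α / 8 - 1 / 2))).aemeasurable
  have hlhs : ∫⁻ t in Ioc (0 : ℝ) 1, ((fun t : ℝ => ENNReal.ofReal (t ^ (α / 8 - 1 / 2))) *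
      fun t : ℝ => absHeat P t f x * ENNReal.ofReal (t ^ (3 * α / 8 - 1 / 2))) t =
      shortFrac P α 1 f x := by
    apply setLIntegral_congr_fun measurableSet_Ioc
    intro t ht
    have ht0 : 0 < t := ht.1
    simp only [Pi.mul_apply]
    rw [mul_left_comm, ← ENNReal.ofReal_mul (by positivity), ← Real.rpow_add ht0]
    congr 3; ring
  have h1 : ∫⁻ t in Ioc (0 : ℝ) 1, ENNReal.ofReal (t ^ (α / 8 - 1 / 2)) ^ (2 : ℝ) =
      ENNReal.ofReal (α / 4)⁻¹ := by
    rw [show (α / 4)⁻¹ = 1 ^ (α / 4 - 1 + 1) / (α / 4 - 1 + 1) by simp,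
      ← lintegral_Ioc_rpow (by linarith) one_pos]
    apply setLIntegral_congr_fun measurableSet_Ioc
    intro t ht
    have ht0 : 0 < t := ht.1
    dsimp only
    rw [ENNReal.ofReal_rpow_of_nonneg (by positivity) (by norm_num), ← Real.rpow_mul ht0.le]
    congr 2; ring
  have h2 : ∫⁻ t in Ioc (0 : ℝ) 1,
      (absHeat P t f x * ENNReal.ofReal (t ^ (3 * α / 8 - 1 / 2))) ^ (2 : ℝ) ≤
      (C * 2 ^ (n + 2) * B) *
        ∫⁻ t in Ioc (0 : ℝ) 1, absHeat P t f x * ENNReal.ofReal (t ^ (α / 4 - 1)) := by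
    rw [← lintegral_const_mul' _ _ (by finiteness)]
    apply lintegral_mono_ae
    filter_upwards [ae_restrict_mem measurableSet_Ioc] with t ht
    have ht0 : 0 < t := ht.1
    have e : ENNReal.ofReal (t ^ (3 * α / 8 - 1 / 2)) * ENNReal.ofReal (t ^ (3 * α / 8 - 1 / 2)) =
        ENNReal.ofReal (t ^ (α / 2)) * ENNReal.ofReal (t ^ (α / 4 - 1)) := by
      rw [← ENNReal.ofReal_mul (by positivity), ← ENNReal.ofReal_mul (by positivity),
        ← Real.rpow_add ht0, ← Real.rpow_add ht0]
      congr 2; ring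
    calc _ = absHeat P t f x * (absHeat P t f x * (ENNReal.ofReal (t ^ (3 * α / 8 - 1 / 2)) *
          ENNReal.ofReal (t ^ (3 * α / 8 - 1 / 2)))) := by rw [ENNReal.rpow_two]; ring
      _ ≤ (C * 2 ^ (n + 2) * profile n Φ t) * (absHeat P t f x *
          (ENNReal.ofReal (t ^ (α / 2)) * ENNReal.ofReal (t ^ (α / 4 - 1)))) := by
          rw [e]; gcongr; exact absHeat_le hK hf hΦ ht0 x
      _ = C * 2 ^ (n + 2) * fracModulus n α Φ t *
          (absHeat P t f x * ENNReal.ofReal (t ^ (α / 4 - 1))) := by unfold fracModulus; ring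
      _ ≤ _ := by gcongr; exact hB t ht0 ht.2
  rw [hlhs, h1] at hCS
  have hsq : ∀ a : ℝ≥0∞, (a ^ (1 / 2 : ℝ)) ^ 2 = a := fun a => by
    rw [← ENNReal.rpow_two, ← ENNReal.rpow_mul]; norm_num
  calc shortFrac P α 1 f x ^ 2 ≤ _ := pow_le_pow_left' hCS 2
    _ = _ := by rw [mul_pow, hsq, hsq]
    _ ≤ _ := by rw [mul_assoc]; gcongr

theorem enorm_heat_one_frac_le {N : ℝ} {M : ℕ} {C : ℝ≥0} (hα : 0 < α) (hNM : N ≤ M)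
    (hK : PolyBound P M C) (f : Rn n → ℂ) (x : Rn n) :
    ‖heat P 1 (frac P α f) x‖ₑ ≤ ENNReal.ofReal (Real.Gamma (α / 2))⁻¹ *
      (C * ENNReal.ofReal ((2 + ‖x‖) ^ M) *
        ∫⁻ y, fracAbs P α f y * ENNReal.ofReal ((1 + ‖y‖) ^ (-N))) := by
  calc ‖heat P 1 (frac P α f) x‖ₑ ≤ absHeat P 1 (frac P α f) x := enorm_heat_le 1 x
    _ ≤ ∫⁻ y, ENNReal.ofReal (Real.Gamma (α / 2))⁻¹ * (‖P 1 x y‖ₑ * fracAbs P α f y) := by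
        apply lintegral_mono; intro y
        dsimp only
        rw [mul_left_comm]
        gcongr
        exact enorm_frac_le hα y
    _ = ENNReal.ofReal (Real.Gamma (α / 2))⁻¹ * ∫⁻ y, ‖P 1 x y‖ₑ * fracAbs P α f y :=
        lintegral_const_mul' _ _ ENNReal.ofReal_ne_top
    _ ≤ _ := by
        gcongr
        refine (lintegral_kernel_mul_fracAbs_le hNM hK one_pos x).trans (le_of_eq ?_)
        rw [Real.one_rpow, Real.sqrt_one, ENNReal.ofReal_one, mul_one]
        congr 4; ring

/-- With `g` the fractional integral, `g - e^{-L} g` is bounded by a multiple of `shortFrac` at time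
`1` plus a constant, and `e^{-L} g` grows at most like `(2 + ‖x‖)^M`. Each is square integrable
against a strong enough polynomial weight. -/
theorem memType_frac (hn : n ≠ 0) (hα : 0 < α) (hT : IsBoundedAnalyticSemigroup T)
    (hP : IsKernelOf P T) (hG : GaussianBound P) {f : Rn n → ℂ} {Φ : ℝ → ℝ≥0∞}
    (hf : Measurable f) (hΦ : BallGrowth (fun y => ‖f y‖ₑ) Φ) (hω : SlowModulus n α Φ)
    {B : ℝ≥0∞} (hBt : B ≠ ⊤) (hB : ∀ t, 0 < t → t ≤ 1 → fracModulus n α Φ t ≤ B)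
    (hconv : FracConverges P α f) : MemType (frac P α f) := by
  obtain ⟨N, hN⟩ := id hconv
  obtain ⟨M, hM⟩ := exists_nat_ge N
  obtain ⟨C, hK⟩ := hG.exists_polyBound M
  obtain ⟨C₁, hK₁⟩ := hG.exists_polyBound (2 * n + 2)
  obtain ⟨D, hD⟩ := exists_lintegral_heat_sub_heat_le (α := α) hn hα hT hP hG
  set G := ENNReal.ofReal (Real.Gamma (α / 2))⁻¹ with hGdef
  set I := ∫⁻ y : Rn n, fracAbs P α f y * ENNReal.ofReal ((1 + ‖y‖) ^ (-N)) with hI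
  have hIt : I < ⊤ := hN
  set b := G * (D * fracModulus n α Φ 1) with hb
  have hbt : b ≠ ⊤ := ENNReal.mul_ne_top ENNReal.ofReal_ne_top
    (ENNReal.mul_ne_top ENNReal.coe_ne_top (fracModulus_lt_top hΦ one_pos).ne)
  set H := G * (C * I) with hH
  have hHt : H ≠ ⊤ := ENNReal.mul_ne_top ENNReal.ofReal_ne_top
    (ENNReal.mul_ne_top ENNReal.coe_ne_top hIt.ne)
  set Q := ENNReal.ofReal (α / 4)⁻¹ * (C₁ * 2 ^ (n + 2) * B) with hQ
  have hQt : Q ≠ ⊤ := by finiteness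
  set S : Rn n → ℝ≥0∞ := fun x =>
    ∫⁻ t in Ioc (0 : ℝ) 1, absHeat P t f x * ENNReal.ofReal (t ^ (α / 4 - 1)) with hS
  have hSm : Measurable S := by
    have hmi : Measurable (fun q : Rn n × ℝ =>
        absHeat P q.2 f q.1 * ENNReal.ofReal (q.2 ^ (α / 4 - 1))) :=
      ((measurable_absHeat_prod hP.1 hf).comp measurable_swap).mul
        ((measurable_snd.pow_const _).ennreal_ofReal)
    exact hmi.lintegral_prod_right'
  have hSt : ∫⁻ x, S x * decay (n + 1) 1 0 x < ⊤ :=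
    lintegral_shortFrac_mul_le hP.1 hK₁ hf hΦ (by positivity : 0 < α / 4)
  -- The power `2M` absorbs the square of the growth of `e^{-L} g`; the remaining `n + 1` give
  -- integrability.
  apply memType_of_lintegral_sq_lt_top (measurable_frac hP.1 hf) (m := 2 * M)
  set E := 16 * b ^ 2 + 4 * (H ^ 2 * 4 ^ M) with hE
  have hEt : E ≠ ⊤ := by finiteness
  calc ∫⁻ x, ‖frac P α f x‖ₑ ^ 2 * decay (n + (2 * M + 1)) 1 0 x
      ≤ ∫⁻ x, ((16 * G ^ 2 * Q) * (S x * decay (n + 1) 1 0 x) + E * decay (n + 1) 1 0 x) := by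
        apply lintegral_mono_ae
        filter_upwards [enorm_frac_sub_heat_frac_le hα hconv hT hP hG hf hΦ one_pos,
          hD f Φ hf hΦ hω 1 one_pos] with x h1 h2
        have hx : ‖frac P α f x‖ₑ ≤ (G * shortFrac P α 1 f x + b) +
            H * ENNReal.ofReal ((2 + ‖x‖) ^ M) := by
          calc ‖frac P α f x‖ₑ
              = ‖(frac P α f x - heat P 1 (frac P α f) x) + heat P 1 (frac P α f) x‖ₑ := by
                rw [sub_add_cancel]
            _ ≤ _ := enorm_add_le _ _
            _ ≤ _ := by
                refine add_le_add ((h1.trans (mul_le_mul' le_rfl h2)).trans (le_of_eq ?_))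
                  ((enorm_heat_one_frac_le hα hM hK f x).trans (le_of_eq ?_))
                · rw [mul_add]
                · rw [hH]; ring
        have hw : decay (n + (2 * M + 1)) 1 0 x = decay (2 * M) 1 0 x * decay (n + 1) 1 0 x := by
          rw [← decay_add _ _ one_pos]; congr 1; ring
        have hpoly : ENNReal.ofReal ((2 + ‖x‖) ^ M) ^ 2 * decay (2 * M) 1 0 x ≤ 4 ^ M := by
          unfold decay
          rw [← ENNReal.ofReal_pow (by positivity), ← ENNReal.ofReal_mul (by positivity),
            zero_sub, norm_neg, div_one, show (4 : ℝ≥0∞) ^ M = ENNReal.ofReal (4 ^ M) by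
              rw [ENNReal.ofReal_pow (by norm_num)]; simp]
          apply ENNReal.ofReal_le_ofReal
          rw [← div_eq_mul_inv, div_le_iff₀ (by positivity), ← pow_mul, mul_comm M 2, pow_mul,
            pow_mul, ← mul_pow]
          apply pow_le_pow_left₀ (by positivity)
          nlinarith [norm_nonneg x]
        calc _ ≤ (4 * (4 * ((G * shortFrac P α 1 f x) ^ 2 + b ^ 2) +
              (H * ENNReal.ofReal ((2 + ‖x‖) ^ M)) ^ 2)) * decay (n + (2 * M + 1)) 1 0 x := by
              gcongr
              refine (pow_le_pow_left' hx 2).trans ((ennreal_add_sq_le _ _).trans ?_)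
              gcongr
              exact ennreal_add_sq_le _ _
          _ = 16 * G ^ 2 * shortFrac P α 1 f x ^ 2 * decay (n + (2 * M + 1)) 1 0 x +
              16 * b ^ 2 * decay (n + (2 * M + 1)) 1 0 x +
              4 * (H ^ 2 * (ENNReal.ofReal ((2 + ‖x‖) ^ M) ^ 2 * decay (2 * M) 1 0 x)) *
                decay (n + 1) 1 0 x := by
              simp only [hw]; ring
          _ ≤ 16 * G ^ 2 * (Q * S x) * decay (n + 1) 1 0 x + 16 * b ^ 2 * decay (n + 1) 1 0 x +
              4 * (H ^ 2 * 4 ^ M) * decay (n + 1) 1 0 x := by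
              have hle : decay (n + (2 * M + 1)) 1 0 x ≤ decay (n + 1) 1 0 x :=
                decay_anti (by omega) one_pos _ _
              have hs := shortFrac_sq_le hα hP.1 (hK₁.mono (by omega)) hf hΦ hBt hB x
              gcongr
          _ = _ := by rw [hE]; ring
    _ = (16 * G ^ 2 * Q) * (∫⁻ x, S x * decay (n + 1) 1 0 x) +
          E * ∫⁻ x : Rn n, decay (n + 1) 1 0 x := by
        have hm : Measurable fun x => S x * decay (n + 1) 1 0 x :=
          hSm.mul (measurable_decay_right _ _ _)
        rw [lintegral_add_left (hm.const_mul _), lintegral_const_mul _ hm,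
          lintegral_const_mul _ (measurable_decay_right _ _ _)]
    _ < ⊤ := ENNReal.add_lt_top.2 ⟨ENNReal.mul_lt_top
        (ENNReal.mul_lt_top (by finiteness) hQt.lt_top) hSt,
        ENNReal.mul_lt_top hEt.lt_top (lintegral_decay_zero_lt_top n)⟩

end memType

/-! ### Growth functions of Morrey type -/

/-- `K₁ s^{n-α} + K₂ s^{n-α+β}`. -/
def powerGrowth (n : ℕ) (α β : ℝ) (K₁ K₂ : ℝ≥0∞) (s : ℝ) : ℝ≥0∞ :=
  K₁ * ENNReal.ofReal (s ^ ((n : ℝ) - α)) + K₂ * ENNReal.ofReal (s ^ ((n : ℝ) - α + β))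

section growth
variable {n : ℕ} {α β : ℝ} {K₁ K₂ : ℝ≥0∞}

/-- The scaling axiom only needs both exponents, `n - α` and `n - α + β`, to be at most `n`. -/
theorem ballGrowth_powerGrowth (hα : 0 ≤ α) (hβ : β ≤ α) (h₁ : K₁ ≠ ⊤) (h₂ : K₂ ≠ ⊤)
    {F : Rn n → ℝ≥0∞}
    (hF : ∀ x s, 0 < s → ∫⁻ y in Metric.ball x s, F y ≤ powerGrowth n α β K₁ K₂ s) :
    BallGrowth F (powerGrowth n α β K₁ K₂) where
  lt_top s _ := by unfold powerGrowth; finiteness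
  scale s hs l hl := by
    have key : ∀ a : ℝ, a ≤ n →
        ENNReal.ofReal ((l * s) ^ a) ≤ ENNReal.ofReal (l ^ n) * ENNReal.ofReal (s ^ a) := by
      intro a ha
      rw [← ENNReal.ofReal_mul (by positivity)]
      apply ENNReal.ofReal_le_ofReal
      rw [Real.mul_rpow (by positivity) hs.le, ← Real.rpow_natCast l n]
      gcongr
    unfold powerGrowth
    calc _ ≤ K₁ * (ENNReal.ofReal (l ^ n) * ENNReal.ofReal (s ^ ((n : ℝ) - α))) +
          K₂ * (ENNReal.ofReal (l ^ n) * ENNReal.ofReal (s ^ ((n : ℝ) - α + β))) := by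
          gcongr <;> exact key _ (by linarith)
      _ = _ := by ring
  ball := hF

theorem fracModulus_powerGrowth {t : ℝ} (ht : 0 < t) :
    fracModulus n α (powerGrowth n α β K₁ K₂) t = K₁ + K₂ * ENNReal.ofReal (t ^ (β / 2)) := by
  have e : ∀ a b : ℝ, -((n : ℝ) / 2) + 1 / 2 * a + α / 2 = b →
      ENNReal.ofReal (t ^ (-((n : ℝ) / 2))) * ENNReal.ofReal ((√t) ^ a) *
        ENNReal.ofReal (t ^ (α / 2)) = ENNReal.ofReal (t ^ b) := by
    rintro a _ rfl
    rw [← ENNReal.ofReal_mul (by positivity), ← ENNReal.ofReal_mul (by positivity),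
      Real.sqrt_eq_rpow, ← Real.rpow_mul ht.le, ← Real.rpow_add ht, ← Real.rpow_add ht]
  unfold fracModulus profile powerGrowth
  calc _ = K₁ * (ENNReal.ofReal (t ^ (-((n : ℝ) / 2))) * ENNReal.ofReal ((√t) ^ ((n : ℝ) - α)) *
        ENNReal.ofReal (t ^ (α / 2))) + K₂ * (ENNReal.ofReal (t ^ (-((n : ℝ) / 2))) *
        ENNReal.ofReal ((√t) ^ ((n : ℝ) - α + β)) * ENNReal.ofReal (t ^ (α / 2))) := by ring
    _ = _ := by
      rw [e _ 0 (by ring), e _ (β / 2) (by ring), Real.rpow_zero, ENNReal.ofReal_one, mul_one]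

theorem slowModulus_powerGrowth (hβ : β ≤ 1 / 2) :
    SlowModulus n α (powerGrowth n α β K₁ K₂) := by
  intro τ t hτ hτt
  have ht : 0 < t := hτ.trans_le hτt
  have h1 : 1 ≤ t / τ := (one_le_div hτ).2 hτt
  rw [fracModulus_powerGrowth ht, fracModulus_powerGrowth hτ, mul_add]
  refine add_le_add ?_ ?_
  · exact le_mul_of_one_le_left' (ENNReal.one_le_ofReal.2 (Real.one_le_rpow h1 (by norm_num)))
  · rw [mul_left_comm, ← ENNReal.ofReal_mul (by positivity)]
    refine mul_le_mul' le_rfl (ENNReal.ofReal_le_ofReal ?_)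
    calc t ^ (β / 2) = (t / τ) ^ (β / 2) * τ ^ (β / 2) := by
          rw [← Real.mul_rpow (by positivity) hτ.le, div_mul_cancel₀ _ hτ.ne']
      _ ≤ _ := mul_le_mul_of_nonneg_right
          (Real.rpow_le_rpow_of_exponent_le h1 (by linarith)) (by positivity)

end growth

/-! ### Mass on balls from the Morrey quotient -/

section morrey
variable {n : ℕ} {p lam α : ℝ}

theorem morreyQ_congr_ae {f g : Rn n → ℂ} (h : f =ᵐ[volume] g) (x₀ : Rn n) (r : ℝ) :
    morreyQ p lam f x₀ r = morreyQ p lam g x₀ r := by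
  unfold morreyQ
  congr 2
  apply lintegral_congr_ae
  filter_upwards [ae_restrict_of_ae h] with x hx
  rw [hx]

theorem rieszAbs_congr_ae {f g : Rn n → ℂ} (h : f =ᵐ[volume] g) (x : Rn n) :
    rieszAbs α f x = rieszAbs α g x := by
  apply lintegral_congr_ae
  filter_upwards [h] with y hy
  rw [hy]

/-- Hölder's inequality: the mass of `f` on a ball in terms of the Morrey quotient. -/
theorem exists_lintegral_ball_le_morreyQ (hn : n ≠ 0) (hp : 1 ≤ p) (hlam : lam = n - α * p)
    (hαn : α < n) : ∃ V : ℝ≥0, ∀ f : Rn n → ℂ, Measurable f → ∀ (x : Rn n) (s : ℝ), 0 < s →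
      ∫⁻ y in Metric.ball x s, ‖f y‖ₑ ≤
        V * morreyQ p lam f x s * ENNReal.ofReal (s ^ ((n : ℝ) - α)) := by
  have hn' : (0 : ℝ) < n := by exact_mod_cast Nat.pos_of_ne_zero hn
  have hp0 : 0 < p := by linarith
  set v := volume (Metric.ball (0 : Rn n) 1) with hv
  have hvt : v ≠ ⊤ := measure_ball_lt_top.ne
  have hexp : 0 ≤ 1 - α / n := by
    rw [sub_nonneg, div_le_one hn']; exact hαn.le
  have hVt : v ^ (1 - α / n) ≠ ⊤ := ENNReal.rpow_ne_top_of_nonneg hexp hvt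
  refine ⟨(v ^ (1 - α / n)).toNNReal, fun f hf x s hs => ?_⟩
  rw [ENNReal.coe_toNNReal hVt]
  set B := Metric.ball x s with hB
  have hvol : volume B = ENNReal.ofReal (s ^ n) * v := by
    rw [hB, Measure.addHaar_ball_of_pos _ _ hs]; simp [hv]
  have hB0 : volume B ≠ 0 := (Metric.measure_ball_pos volume _ hs).ne'
  have hBt : volume B ≠ ⊤ := measure_ball_lt_top.ne
  have hHolder : ∫⁻ y in B, ‖f y‖ₑ ≤ (∫⁻ y in B, ‖f y‖ₑ ^ p) ^ (1 / p) * volume B ^ (1 - 1 / p) := by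
    have h := eLpNorm_le_eLpNorm_mul_rpow_measure_univ (μ := volume.restrict B) (p := 1)
      (q := ENNReal.ofReal p) (f := f) (by rw [ENNReal.one_le_ofReal]; exact hp)
      hf.aestronglyMeasurable
    rw [eLpNorm_one_eq_lintegral_enorm, eLpNorm_eq_lintegral_rpow_enorm_toReal
      (by simpa using hp0) ENNReal.ofReal_ne_top, ENNReal.toReal_ofReal hp0.le,
      Measure.restrict_apply_univ, ENNReal.toReal_one, div_one] at h
    exact h
  have hQ : (∫⁻ y in B, ‖f y‖ₑ ^ p) ^ (1 / p) = morreyQ p lam f x s * volume B ^ (lam / (p * n)) := by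
    unfold morreyQ
    rw [ENNReal.div_mul_cancel]
    · exact (ENNReal.rpow_pos (pos_iff_ne_zero.2 hB0) hBt).ne'
    · exact ENNReal.rpow_ne_top_of_ne_zero hB0 hBt
  calc ∫⁻ y in B, ‖f y‖ₑ ≤ morreyQ p lam f x s * (volume B ^ (lam / (p * n)) *
        volume B ^ (1 - 1 / p)) := by rw [← mul_assoc, ← hQ]; exact hHolder
    _ = morreyQ p lam f x s * volume B ^ (1 - α / n) := by
        rw [← ENNReal.rpow_add _ _ hB0 hBt]
        -- The exponents add up: `λ/(pn) + 1 - 1/p = 1 - α/n`, because `λ = n - αp`.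
        congr 2
        rw [hlam]; field_simp; ring
    _ = morreyQ p lam f x s * (ENNReal.ofReal (s ^ ((n : ℝ) - α)) * v ^ (1 - α / n)) := by
        rw [hvol, ENNReal.mul_rpow_of_nonneg _ _ hexp,
          ENNReal.ofReal_rpow_of_nonneg (by positivity) hexp, ← Real.rpow_natCast,
          ← Real.rpow_mul hs.le]
        congr 4
        field_simp
    _ = _ := by ring

theorem morreyQ_le_morreyNorm (f : Rn n → ℂ) (x : Rn n) {r : ℝ} (hr : 0 < r) :
    morreyQ p lam f x r ≤ morreyNorm p lam f :=
  le_iSup_of_le x (le_iSup_of_le r (le_iSup_of_le hr le_rfl))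

theorem MemVMorrey.congr_ae {f g : Rn n → ℂ} (hf : MemVMorrey p lam f) (h : f =ᵐ[volume] g) :
    MemVMorrey p lam g := by
  obtain ⟨⟨h1, h2⟩, h3⟩ := hf
  simp only [morreyNorm, morreyQ_congr_ae h] at h2 h3
  exact ⟨⟨h1.congr h, h2⟩, h3⟩

end morrey

/-! ### Vanishing oscillation and invariance under almost everywhere equality -/

section main
variable {n : ℕ} {P : ℝ → Rn n → Rn n → ℂ} {T : ℝ → L2 n →L[ℂ] L2 n} {p lam α : ℝ}

theorem bmoNorm_le {g : Rn n → ℂ} {B : ℝ≥0∞} (h : ∀ x₀ r, 0 < r → osc P g x₀ r ≤ B) :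
    bmoNorm P g ≤ B := by
  refine essSup_le_of_ae_le B ?_
  exact Eventually.of_forall fun x => iSup_le fun x₀ => iSup_le fun r => iSup_le fun hr =>
    iSup_le fun _ => h x₀ r hr

/-- Below a radius `ρ` the Morrey quotient is at most `δ`; above it, `s^{n-α} ≤ ρ^{-β} s^{n-α+β}`.
So the mass of `f` has a growth function with small leading coefficient `K₁`, and the modulus at `r`
is at most `D K₁ + D K₂ r^β`. The long-time tail thus needs no separate treatment. -/
theorem tendsto_vmoModulus_frac {D V : ℝ≥0} (hα : 0 < α)
    (hD : ∀ (f : Rn n → ℂ) (Φ : ℝ → ℝ≥0∞), Measurable f →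
      BallGrowth (fun y => ‖f y‖ₑ) Φ → SlowModulus n α Φ → FracConverges P α f →
      ∀ (x₀ : Rn n) (r : ℝ), 0 < r → osc P (frac P α f) x₀ r ≤ D * fracModulus n α Φ (r ^ 2))
    (hV : ∀ f : Rn n → ℂ, Measurable f → ∀ (x : Rn n) (s : ℝ), 0 < s →
      ∫⁻ y in Metric.ball x s, ‖f y‖ₑ ≤
        V * morreyQ p lam f x s * ENNReal.ofReal (s ^ ((n : ℝ) - α)))
    {f : Rn n → ℂ} (hf : Measurable f) (hM : MemVMorrey p lam f) (hconv : FracConverges P α f) :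
    Tendsto (vmoModulus P (frac P α f)) (𝓝[>] 0) (𝓝 0) := by
  set N := morreyNorm p lam f with hN
  have hNt : N ≠ ⊤ := hM.1.2.ne
  -- The bound by `α` is for the scaling axiom, the bound by `1/2` for `SlowModulus`.
  set β := min α (1 / 2) with hβ
  have hβ0 : 0 < β := lt_min hα (by norm_num)
  rw [ENNReal.tendsto_nhds_zero]
  intro ε hε
  set δ : ℝ≥0∞ := ε / (2 * (D * V + 1)) with hδ
  have hδ0 : 0 < δ := ENNReal.div_pos hε.ne' (by finiteness)
  obtain ⟨ρ, hρ, hρδ⟩ : ∃ ρ : ℝ, 0 < ρ ∧ ∀ s, 0 < s → s < ρ → ∀ x, morreyQ p lam f x s ≤ δ := by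
    have h := (ENNReal.tendsto_nhds_zero.1 hM.2) δ hδ0
    obtain ⟨ρ, hρ, h⟩ := mem_nhdsGT_iff_exists_Ioo_subset.1 h
    exact ⟨ρ, hρ, fun s hs hsρ x => (le_iSup (fun x => morreyQ p lam f x s) x).trans (h ⟨hs, hsρ⟩)⟩
  -- The minimum with `N` keeps `K₁` finite even when `ε`, hence `δ`, is `⊤`.
  set K₁ := V * min δ N with hK₁
  set K₂ := V * N * ENNReal.ofReal (ρ ^ (-β)) with hK₂
  have hK₁t : K₁ ≠ ⊤ := ENNReal.mul_ne_top ENNReal.coe_ne_top (ne_top_of_le_ne_top hNt (min_le_right _ _))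
  have hK₂t : K₂ ≠ ⊤ := by finiteness
  have hΦ : BallGrowth (fun y => ‖f y‖ₑ) (powerGrowth n α β K₁ K₂) := by
    refine ballGrowth_powerGrowth hα.le (min_le_left _ _) hK₁t hK₂t fun x s hs => ?_
    refine (hV f hf x s hs).trans ?_
    have hNs : morreyQ p lam f x s ≤ N := morreyQ_le_morreyNorm f x hs
    unfold powerGrowth
    rcases lt_or_ge s ρ with h | h
    · refine le_add_right ?_
      rw [hK₁]
      gcongr
      exact le_min (hρδ s hs h x) hNs
    · refine le_add_left ?_
      rw [hK₂, mul_assoc (V * N : ℝ≥0∞), ← ENNReal.ofReal_mul (by positivity)]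
      gcongr
      rw [Real.rpow_add hs, mul_left_comm]
      apply le_mul_of_one_le_right (by positivity)
      rw [Real.rpow_neg hρ.le, ← div_eq_inv_mul, one_le_div (by positivity)]
      gcongr
  have hosc : ∀ r, 0 < r → vmoModulus P (frac P α f) r ≤
      D * K₁ + D * K₂ * ENNReal.ofReal ((r ^ 2) ^ (β / 2)) := by
    intro r hr
    refine iSup_le fun x₀ => ?_
    refine (hD f _ hf hΦ (slowModulus_powerGrowth (min_le_right _ _)) hconv x₀ r hr).trans ?_
    rw [fracModulus_powerGrowth (by positivity)]
    exact le_of_eq (by ring)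
  have hDK₁ : D * K₁ ≤ ε / 2 := by
    calc D * K₁ ≤ (D * V + 1) * δ := by
          rw [hK₁, ← mul_assoc]
          exact mul_le_mul' le_self_add (min_le_left _ _)
      _ = ε / 2 := by
          rw [hδ, ENNReal.div_eq_inv_mul, ENNReal.mul_inv (by simp) (by simp),
            ENNReal.div_eq_inv_mul]
          calc _ = 2⁻¹ * ε * ((D * V + 1) * (D * V + 1 : ℝ≥0∞)⁻¹) := by ring
            _ = _ := by rw [ENNReal.mul_inv_cancel (by simp) (by finiteness), mul_one]
  have hlim : Tendsto (fun r : ℝ => D * K₂ * ENNReal.ofReal ((r ^ 2) ^ (β / 2))) (𝓝[>] 0) (𝓝 0) := by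
    have h1 : ContinuousAt (fun r : ℝ => (r ^ 2) ^ (β / 2)) 0 :=
      ContinuousAt.rpow_const (by fun_prop) (Or.inr (by positivity))
    have h2 : Tendsto (fun r : ℝ => ENNReal.ofReal ((r ^ 2) ^ (β / 2))) (𝓝[>] 0) (𝓝 0) := by
      have := (ENNReal.continuous_ofReal.continuousAt.comp h1).tendsto
      simp only [Function.comp_def, ne_eq, OfNat.ofNat_ne_zero, not_false_eq_true, zero_pow] at this
      rw [Real.zero_rpow (by positivity), ENNReal.ofReal_zero] at this
      exact this.mono_left nhdsWithin_le_nhds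
    have := ENNReal.Tendsto.const_mul (a := D * K₂) h2 (Or.inr (by finiteness))
    rwa [mul_zero] at this
  filter_upwards [(ENNReal.tendsto_nhds_zero.1 hlim) (ε / 2) (ENNReal.half_pos hε.ne'),
    self_mem_nhdsWithin] with r hr hr0
  exact (hosc r hr0).trans ((add_le_add hDK₁ hr).trans (ENNReal.add_halves ε).le)

theorem FracConverges.congr_ae {f g : Rn n → ℂ} (hf : FracConverges P α f) (h : f =ᵐ[volume] g) :
    FracConverges P α g := by
  unfold FracConverges at hf ⊢
  simpa only [heat_congr_ae h] using hf

theorem frac_congr_ae {f g : Rn n → ℂ} (h : f =ᵐ[volume] g) : frac P α f = frac P α g := by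
  ext x
  simp only [frac, heat_congr_ae h]

end main

end FracMorrey

end

open FracMorrey in
theorem theorem3p2 (n : ℕ)
    (L : FracMorrey.L2 n →ₗ.[ℂ] FracMorrey.L2 n)
    (T : ℝ → FracMorrey.L2 n →L[ℂ] FracMorrey.L2 n)
    (hT : FracMorrey.IsBoundedAnalyticSemigroup T)
    (hL : FracMorrey.IsGeneratorOf L T)
    (P : ℝ → FracMorrey.Rn n → FracMorrey.Rn n → ℂ)
    (hP : FracMorrey.IsKernelOf P T)
    (hG : FracMorrey.GaussianBound P)
    (α p lam : ℝ) (hα : 0 < α) (hαn : α < n) (hp : 1 ≤ p) (hpn : p < n / α)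
    (hlam : lam = n - α * p) :
    ∃ C : ℝ, 0 < C ∧ ∀ f : FracMorrey.Rn n → ℂ, FracMorrey.MemVMorrey p lam f →
      ((∃ x, FracMorrey.rieszAbs α f x < ⊤) → FracMorrey.FracConverges P α f) ∧
      (FracMorrey.FracConverges P α f →
        FracMorrey.MemVMO P (FracMorrey.frac P α f) ∧
        FracMorrey.bmoNorm P (FracMorrey.frac P α f)
          ≤ ENNReal.ofReal C * FracMorrey.morreyNorm p lam f ∧
        Tendsto (fun r : ℝ => FracMorrey.vmoModulus P (FracMorrey.frac P α f) r)
          (𝓝[>] 0) (𝓝 0)) := by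
  have hn : n ≠ 0 := by
    rintro rfl
    rw [Nat.cast_zero] at hαn
    linarith
  obtain ⟨D, hD⟩ := exists_osc_frac_le (α := α) hn hα hT hP hG
  obtain ⟨V, hV⟩ := exists_lintegral_ball_le_morreyQ hn hp hlam hαn
  -- The summand `1` only makes the constant positive.
  refine ⟨D * V + 1, by positivity, fun f₀ hf₀ => ?_⟩
  -- A Borel representative suffices, as every quantity involved depends only on the class of `f`
  -- modulo null sets.
  obtain ⟨f, hf, hff⟩ := hf₀.1.1.aestronglyMeasurable.aemeasurable
  have hM : MemVMorrey p lam f := hf₀.congr_ae hff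
  have hnorm : morreyNorm p lam f₀ = morreyNorm p lam f := by
    simp only [morreyNorm, morreyQ_congr_ae hff]
  set K := V * morreyNorm p lam f with hK
  have hKt : K ≠ ⊤ := ENNReal.mul_ne_top ENNReal.coe_ne_top hM.1.2.ne
  -- For the norm bound the second term is switched off; `fracModulus` is then the constant `K` at
  -- every scale.
  have hΦ : BallGrowth (fun y => ‖f y‖ₑ) (powerGrowth n α 0 K 0) := by
    refine ballGrowth_powerGrowth hα.le hα.le hKt ENNReal.zero_ne_top fun x s hs => ?_
    refine (hV f hf x s hs).trans (le_add_right ?_)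
    rw [hK]
    gcongr
    exact morreyQ_le_morreyNorm f x hs
  have hω : SlowModulus n α (powerGrowth n α 0 K 0) := slowModulus_powerGrowth (by norm_num)
  have hmod : ∀ t, 0 < t → fracModulus n α (powerGrowth n α 0 K 0) t = K := fun t ht => by
    rw [fracModulus_powerGrowth ht, zero_mul, add_zero]
  rw [frac_congr_ae hff, hnorm]
  refine ⟨fun ⟨x, hx⟩ => ?_, fun hconv₀ => ?_⟩
  · rw [rieszAbs_congr_ae hff] at hx
    exact (fracConverges_of_rieszAbs_lt_top hα hαn hP.1 hG hf hΦ hx).congr_ae hff.symm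
  · have hconv : FracConverges P α f := hconv₀.congr_ae hff
    have hosc : ∀ x₀ r, 0 < r → osc P (frac P α f) x₀ r ≤ D * K := fun x₀ r hr => by
      have := hD f _ hf hΦ hω hconv x₀ r hr
      rwa [hmod _ (by positivity)] at this
    have hbmo := bmoNorm_le hosc
    have hvmo := tendsto_vmoModulus_frac hα hD hV hf hM hconv
    have htype := memType_frac hn hα hT hP hG hf hΦ hω hKt (fun t ht _ => (hmod t ht).le) hconv
    refine ⟨⟨⟨htype, hbmo.trans_lt (ENNReal.mul_lt_top ENNReal.coe_lt_top hKt.lt_top)⟩, hvmo⟩,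
      hbmo.trans ?_, hvmo⟩
    rw [hK, ← mul_assoc]
    gcongr
    rw [ENNReal.ofReal_add (by positivity) zero_le_one, ENNReal.ofReal_mul (by positivity),
      ENNReal.ofReal_coe_nnreal, ENNReal.ofReal_coe_nnreal]
    exact le_self_add
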